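/- Let $M$ be a smooth (Hausdorff, finite-dimensional, boundaryless) manifold and let $G$ be a (finite-dimensional real) Lie group with Lie algebra $\mathfrak g=T_1G$. A \emph{path} from $x$ to $y$ is a smooth map $\gamma:[0,1]\to M$ that is constant, equal to $x$, near $0$ and constant, equal to $y$, near $1$. Two paths $\gamma,\delta$ from $x$ to $y$ are \emph{thinly homotopic} if there is a smooth map $h:[0,1]^2\to M$ with $h(s,\cdot)=\gamma$ for $s$ near $0$, $h(s,\cdot)=\delta$ for $s$ near $1$, $h(\cdot,t)=x$ for $t$ near $0$, $h(\cdot,t)=y$ for $t$ near $1$, whose differential has rank less than $2$ at every point. The \emph{path groupoid} $\mathcal P_1(M)$ has the points of $M$ as objects and the thin homotopy classes $[\gamma]$ of paths from $x$ to $y$ as morphisms $x\to y$; composition is concatenation, identities are the constant paths, and inverses are the reversed paths. View $G$ as a groupoid with one object, so that a functor $\mathrm{hol}:\mathcal P_1(M)\to G$ satisfies $\mathrm{hol}(\gamma\delta)=\mathrm{hol}(\gamma)\,\mathrm{hol}(\delta)$, where $\gamma\delta$ means first $\delta$, then $\gamma$. Such a functor is \emph{smooth} if for every open $U\subseteq\mathbb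 R^k$ and every family of paths $(c_u)_{u\in U}$ with $(u,t)\mapsto c_u(t)$ smooth, the map $U\to G$, $u\mapsto \mathrm{hol}([c_u])$, is smooth. \textbf{Theorem.} Connections on the trivial $G$-bundle over $M$, i.e. smooth $\mathfrak g$-valued $1$-forms $A$ on $M$, are in one-to-one correspondence with smooth functors $\mathrm{hol}:\mathcal P_1(M)\to G$. More precisely, for every connection $A$ and every path $\gamma$ the equation $$g'(t)=A(\gamma'(t))\,g(t),\qquad g(0)=1,$$ (where $A(\gamma'(t))\,g(t)$ is the image of $A(\gamma'(t))$ under the differential at $1$ of right translation by $g(t)$) has a unique solution $g$, and there is a bijection from connections to smooth functors that sends $A$ to the functor $\mathrm{hol}$ with $\mathrm{hol}([\gamma])=g(1)=\mathcal P\exp\int_\gamma A$ for every path $\gamma$. The inverse bijection sends $\mathrm{hol}$ to the $1$-form $A$ that satisfies $$A(c'(0))=\frac{\mathrm d}{\mathrm ds}\Big|_{s=0}\mathrm{hol}([c_s])$$ for every smooth curve $c:\mathbb R\to M$ (in particular the derivative exists), where $c_s$ is the piece of $c$ between the parameters $0$ and $s$, reparametrized as $c_s(t)=c(s\,\sigma(t))$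 by a fixed smooth nondecreasing function $\sigma:[0,1]\to[0,1]$ that is $0$ on $[0,1/3]$ and $1$ on $[2/3,1]$. -/

import Mathlib

open scoped Manifold ContDiff

noncomputable section

/-! ### A smooth step function -/

/-- A smooth monotone step, equal to `0` on `(-∞, 1/3]` and to `1` on `[2/3, ∞)`. -/
def smoothStep (t : ℝ) : ℝ := Real.smoothTransition (3 * t - 1)

lemma smoothStep_contDiff : ContDiff ℝ ∞ smoothStep :=
  Real.smoothTransition.contDiff.comp ((contDiff_const.mul contDiff_id).sub contDiff_const)

lemma smoothStep_of_le {t : ℝ} (h : t ≤ 1 / 3) : smoothStep t = 0 :=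
  Real.smoothTransition.zero_of_nonpos (by linarith)

lemma smoothStep_of_ge {t : ℝ} (h : 2 / 3 ≤ t) : smoothStep t = 1 :=
  Real.smoothTransition.one_of_one_le (by linarith)

lemma smoothStep_nonneg (t : ℝ) : 0 ≤ smoothStep t := Real.smoothTransition.nonneg _

lemma smoothStep_le_one (t : ℝ) : smoothStep t ≤ 1 := Real.smoothTransition.le_one _

section Paths

variable {E : Type*} [NormedAddCommGroup E] [NormedSpace ℝ E]
  {H : Type*} [TopologicalSpace H] (I : ModelWithCorners ℝ E H)
  {M : Type*} [TopologicalSpace M] [ChartedSpace H M]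

/-! ### Paths and thin homotopies -/

/-- A smooth path `[0,1] → M` from `x` to `y` with sitting instants, i.e. one that is constant near
both ends of `[0,1]`. Such a path is recorded as its unique extension to a map `ℝ → M` that is
constant on `(-∞, 0]` and on `[1, ∞)`; this extension is again smooth. -/
structure LazyPath (x y : M) where
  /-- The underlying map. -/
  toFun : ℝ → M
  smooth : ContMDiff 𝓘(ℝ, ℝ) I ∞ toFun
  lazy : ∃ ε > 0, (∀ t ≤ ε, toFun t = x) ∧ ∀ t, 1 - ε ≤ t → toFun t = y

instance (x y : M) : CoeFun (LazyPath I x y) (fun _ => ℝ → M) := ⟨LazyPath.toFun⟩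

/-- A smooth map from the plane to `M` whose differential has rank less than two everywhere. -/
structure IsThin (h : ℝ × ℝ → M) : Prop where
  smooth : ContMDiff 𝓘(ℝ, ℝ × ℝ) I ∞ h
  rank_lt : ∀ p, Module.finrank ℝ
    (LinearMap.range (mfderiv 𝓘(ℝ, ℝ × ℝ) I h p).toLinearMap) < 2

/-- `γ` and `δ` are thinly homotopic: there is a smooth homotopy `h (s, t)` relative to the end
points, from `γ` (at `s = 0`) to `δ` (at `s = 1`), whose differential has rank less than two
everywhere. The homotopy is independent of `s` near `s = 0` and near `s = 1`, and of `t` near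
`t = 0` and near `t = 1`; it is recorded, like the paths, by its constant extension from the square
`[0,1] × [0,1]` to the plane. -/
def ThinHomotopic {x y : M} (γ δ : LazyPath I x y) : Prop :=
  ∃ h : ℝ × ℝ → M, IsThin I h ∧ ∃ ε > 0,
    (∀ s t, s ≤ ε → h (s, t) = γ t) ∧ (∀ s t, 1 - ε ≤ s → h (s, t) = δ t) ∧
    (∀ s t, t ≤ ε → h (s, t) = x) ∧ (∀ s t, 1 - ε ≤ t → h (s, t) = y)

variable {I}

/-! Helper facts on thin maps and gluing. -/

lemma glue_eventuallyEq {V X : Type*} [TopologicalSpace V] (f g : V → X) (l : V → ℝ)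
    (hl : Continuous l) (ε : ℝ) (hε : 0 < ε)
    (hfg : ∀ p, 1 - ε ≤ 2 * l p → 2 * l p - 1 ≤ ε → f p = g p) (p : V) :
    (fun q => if l q ≤ 1 / 2 then f q else g q) =ᶠ[nhds p] f ∨
      (fun q => if l q ≤ 1 / 2 then f q else g q) =ᶠ[nhds p] g := by
  rcases le_or_gt (l p) (1 / 2) with h | h
  · left
    filter_upwards [(isOpen_lt hl continuous_const).mem_nhds
      (show l p < (1 + ε) / 2 by linarith)] with q hq
    have hq : l q < (1 + ε) / 2 := hq
    by_cases h' : l q ≤ 1 / 2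
    · simp only [h', if_true]
    · simp only [h', if_false]
      exact (hfg q (by linarith) (by linarith)).symm
  · right
    filter_upwards [(isOpen_lt continuous_const hl).mem_nhds h] with q hq
    have hq : 1 / 2 < l q := hq
    simp only [not_le.2 hq, if_false]

lemma IsThin.glue {f g : ℝ × ℝ → M} (hf : IsThin I f) (hg : IsThin I g) (l : ℝ × ℝ → ℝ)
    (hl : Continuous l) (ε : ℝ) (hε : 0 < ε)
    (hfg : ∀ p, 1 - ε ≤ 2 * l p → 2 * l p - 1 ≤ ε → f p = g p) :
    IsThin I (fun q => if l q ≤ 1 / 2 then f q else g q) := by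
  have key := glue_eventuallyEq f g l hl ε hε hfg
  refine ⟨fun p => ?_, fun p => ?_⟩
  · rcases key p with h | h
    · exact (hf.smooth p).congr_of_eventuallyEq h
    · exact (hg.smooth p).congr_of_eventuallyEq h
  · have aux : ∀ k₁ k₂ : ℝ × ℝ → M, k₁ =ᶠ[nhds p] k₂ → IsThin I k₂ → Module.finrank ℝ
        (LinearMap.range (mfderiv 𝓘(ℝ, ℝ × ℝ) I k₁ p).toLinearMap) < 2 := by
      intro k₁ k₂ h hk
      have h1 : k₁ p = k₂ p := h.eq_of_nhds
      have h2 := hk.rank_lt p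
      have h3 : ∀ (L₁ : TangentSpace 𝓘(ℝ, ℝ × ℝ) p →L[ℝ] TangentSpace I (k₁ p)),
          HasMFDerivAt 𝓘(ℝ, ℝ × ℝ) I k₁ p L₁ →
          Module.finrank ℝ (LinearMap.range L₁.toLinearMap) < 2 := by
        intro L₁ hL
        have h4 := (hL.congr_of_eventuallyEq h.symm).mfderiv
        rw [h4] at h2
        exact h2
      by_cases hd : MDifferentiableAt 𝓘(ℝ, ℝ × ℝ) I k₁ p
      · exact h3 _ hd.hasMFDerivAt
      · exact absurd (((hk.smooth p).mdifferentiableAt (by simp)).congr_of_eventuallyEq h) hd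
    rcases key p with h | h
    · exact aux _ _ h hf
    · exact aux _ _ h hg

lemma IsThin.comp {h : ℝ × ℝ → M} (hh : IsThin I h) {φ : ℝ × ℝ → ℝ × ℝ} (hφ : ContDiff ℝ ∞ φ) :
    IsThin I (fun p => h (φ p)) := by
  refine ⟨hh.smooth.comp hφ.contMDiff, fun p => ?_⟩
  have h1 : mfderiv 𝓘(ℝ, ℝ × ℝ) I (h ∘ φ) p = _ :=
    mfderiv_comp p ((hh.smooth (φ p)).mdifferentiableAt (by simp))
      ((hφ.contMDiff p).mdifferentiableAt (by simp))
  change Module.finrank ℝ (LinearMap.range (mfderiv 𝓘(ℝ, ℝ × ℝ) I (h ∘ φ) p).toLinearMap) < 2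
  rw [h1]
  refine lt_of_le_of_lt ?_ (hh.rank_lt (φ p))
  have : FiniteDimensional ℝ (TangentSpace 𝓘(ℝ, ℝ × ℝ) (φ p)) :=
    inferInstanceAs (FiniteDimensional ℝ (ℝ × ℝ))
  exact Submodule.finrank_mono (LinearMap.range_comp_le_range _ _)

lemma IsThin.of_path {c : ℝ → M} (hc : ContMDiff 𝓘(ℝ, ℝ) I ∞ c) {φ : ℝ × ℝ → ℝ}
    (hφ : ContDiff ℝ ∞ φ) : IsThin I (fun p => c (φ p)) := by
  refine ⟨hc.comp hφ.contMDiff, fun p => ?_⟩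
  have h1 : mfderiv 𝓘(ℝ, ℝ × ℝ) I (c ∘ φ) p = _ :=
    mfderiv_comp p ((hc (φ p)).mdifferentiableAt (by simp))
      ((hφ.contMDiff p).mdifferentiableAt (by simp))
  change Module.finrank ℝ (LinearMap.range (mfderiv 𝓘(ℝ, ℝ × ℝ) I (c ∘ φ) p).toLinearMap) < 2
  rw [h1]
  have : FiniteDimensional ℝ (TangentSpace 𝓘(ℝ, ℝ) (φ p)) :=
    inferInstanceAs (FiniteDimensional ℝ ℝ)
  have h2 := LinearMap.finrank_range_le (mfderiv 𝓘(ℝ, ℝ) I c (φ p)).toLinearMap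
  have h3 : Module.finrank ℝ (TangentSpace 𝓘(ℝ, ℝ) (φ p)) = 1 := Module.finrank_self ℝ
  have h4 := Submodule.finrank_mono (LinearMap.range_comp_le_range
    (mfderiv 𝓘(ℝ, ℝ × ℝ) 𝓘(ℝ, ℝ) φ p).toLinearMap (mfderiv 𝓘(ℝ, ℝ) I c (φ p)).toLinearMap)
  exact lt_of_le_of_lt h4 (by omega)

/-! Thin homotopy is an equivalence relation. -/

lemma ThinHomotopic.refl {x y : M} (γ : LazyPath I x y) : ThinHomotopic I γ γ := by
  obtain ⟨ε, hε, h0, h1⟩ := γ.lazy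
  exact ⟨fun p => γ p.2, IsThin.of_path γ.smooth contDiff_snd, ε, hε, fun _ _ _ => rfl,
    fun _ _ _ => rfl, fun _ t ht => h0 t ht, fun _ t ht => h1 t ht⟩

lemma ThinHomotopic.symm {x y : M} {γ δ : LazyPath I x y} (h : ThinHomotopic I γ δ) :
    ThinHomotopic I δ γ := by
  obtain ⟨k, hk, ε, hε, h0, h1, h2, h3⟩ := h
  exact ⟨fun p => k (1 - p.1, p.2),
    hk.comp ((contDiff_const.sub contDiff_fst).prodMk contDiff_snd), ε, hε,
    fun s t hs => h1 _ _ (by linarith), fun s t hs => h0 _ _ (by linarith),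
    fun s t ht => h2 _ _ ht, fun s t ht => h3 _ _ ht⟩

lemma ThinHomotopic.trans {x y : M} {γ δ η : LazyPath I x y} (h : ThinHomotopic I γ δ)
    (h' : ThinHomotopic I δ η) : ThinHomotopic I γ η := by
  obtain ⟨k, hk, ε, hε, h0, h1, h2, h3⟩ := h
  obtain ⟨k', hk', ε', hε', h0', h1', h2', h3'⟩ := h'
  have hm : 0 < min ε ε' := lt_min hε hε'
  have hm1 := min_le_left ε ε'
  have hm2 := min_le_right ε ε'
  have hm3 : 0 < min (min ε ε' / 2) (1 / 4) := lt_min (by linarith) (by norm_num)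
  have hm4 := min_le_left (min ε ε' / 2) (1 / 4)
  have hm5 := min_le_right (min ε ε' / 2) (1 / 4)
  refine ⟨_, IsThin.glue
    (hk.comp (φ := fun p => (2 * p.1, p.2))
      ((contDiff_const.mul contDiff_fst).prodMk contDiff_snd))
    (hk'.comp (φ := fun p => (2 * p.1 - 1, p.2))
      (((contDiff_const.mul contDiff_fst).sub contDiff_const).prodMk contDiff_snd))
    (fun p => p.1) continuous_fst (min ε ε') hm ?_, min (min ε ε' / 2) (1 / 4), hm3, ?_, ?_, ?_, ?_⟩
  · intro p hp hp'
    exact (h1 _ _ (by linarith)).trans (h0' _ _ (by linarith)).symm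
  · intro s t hs
    simp only [show s ≤ 1 / 2 by linarith, if_true]
    exact h0 _ _ (by linarith)
  · intro s t hs
    simp only [show ¬ s ≤ 1 / 2 by linarith, if_false]
    exact h1' _ _ (by linarith)
  · intro s t ht
    dsimp only
    split_ifs
    · exact h2 _ _ (by linarith)
    · exact h2' _ _ (by linarith)
  · intro s t ht
    dsimp only
    split_ifs
    · exact h3 _ _ (by linarith)
    · exact h3' _ _ (by linarith)

variable (I) in
/-- Thin homotopy as an equivalence relation on the paths from `x` to `y`. -/
def thinSetoid (x y : M) : Setoid (LazyPath I x y) where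
  r := ThinHomotopic I
  iseqv := ⟨ThinHomotopic.refl, ThinHomotopic.symm, ThinHomotopic.trans⟩

/-! ### Operations on paths -/

namespace LazyPath

/-- The constant path. -/
def refl (I : ModelWithCorners ℝ E H) (x : M) : LazyPath I x x where
  toFun _ := x
  smooth := contMDiff_const
  lazy := ⟨1, one_pos, fun _ _ => rfl, fun _ _ => rfl⟩

/-- The reversed path. -/
def symm {x y : M} (γ : LazyPath I x y) : LazyPath I y x where
  toFun t := γ (1 - t)
  smooth := γ.smooth.comp (contDiff_const.sub contDiff_id).contMDiff
  lazy := by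
    obtain ⟨ε, hε, h0, h1⟩ := γ.lazy
    exact ⟨ε, hε, fun t ht => h1 _ (by linarith), fun t ht => h0 _ (by linarith)⟩

/-- Concatenation: first `γ`, then `δ`, each at double speed. -/
def trans {x y z : M} (γ : LazyPath I x y) (δ : LazyPath I y z) : LazyPath I x z where
  toFun t := if t ≤ 1 / 2 then γ (2 * t) else δ (2 * t - 1)
  smooth := by
    obtain ⟨ε, hε, h0, h1⟩ := γ.lazy
    obtain ⟨ε', hε', h0', h1'⟩ := δ.lazy
    have hm1 := min_le_left ε ε'
    have hm2 := min_le_right ε ε'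
    have s1 : ContMDiff 𝓘(ℝ, ℝ) I ∞ (fun t : ℝ => γ (2 * t)) :=
      γ.smooth.comp (contDiff_const.mul contDiff_id).contMDiff
    have s2 : ContMDiff 𝓘(ℝ, ℝ) I ∞ (fun t : ℝ => δ (2 * t - 1)) :=
      δ.smooth.comp ((contDiff_const.mul contDiff_id).sub contDiff_const).contMDiff
    intro t
    rcases glue_eventuallyEq (fun t : ℝ => γ (2 * t)) (fun t : ℝ => δ (2 * t - 1)) (fun t => t)
      continuous_id (min ε ε') (lt_min hε hε')
      (fun p hp hp' => (h1 _ (by linarith)).trans (h0' _ (by linarith)).symm) t with h | h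
    · exact (s1 t).congr_of_eventuallyEq h
    · exact (s2 t).congr_of_eventuallyEq h
  lazy := by
    obtain ⟨ε, hε, h0, h1⟩ := γ.lazy
    obtain ⟨ε', hε', h0', h1'⟩ := δ.lazy
    have hm1 := min_le_left (min ε ε' / 2) (1 / 4)
    have hm2 := min_le_right (min ε ε' / 2) (1 / 4)
    have hm3 := min_le_left ε ε'
    have hm4 := min_le_right ε ε'
    have hm5 : 0 < min ε ε' := lt_min hε hε'
    refine ⟨min (min ε ε' / 2) (1 / 4), lt_min (by linarith) (by norm_num), ?_, ?_⟩
    · intro t ht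
      simp only [show t ≤ 1 / 2 by linarith, if_true]
      exact h0 _ (by linarith)
    · intro t ht
      simp only [show ¬ t ≤ 1 / 2 by linarith, if_false]
      exact h1' _ (by linarith)

/-- The piece of a smooth curve `c` between the parameters `0` and `s`, reparametrized so as to be
a path on `[0,1]` with sitting instants. -/
def ofCurve (c : ℝ → M) (hc : ContMDiff 𝓘(ℝ, ℝ) I ∞ c) (s : ℝ) : LazyPath I (c 0) (c s) where
  toFun t := c (s * smoothStep t)
  smooth := hc.comp (contDiff_const.mul smoothStep_contDiff).contMDiff
  lazy := ⟨1 / 3, by norm_num, fun t ht => by rw [smoothStep_of_le ht, mul_zero],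
    fun t ht => by rw [smoothStep_of_ge (by linarith), mul_one]⟩

/-- A path with its time run through the smooth step. -/
def slow {x y : M} (γ : LazyPath I x y) : LazyPath I x y where
  toFun t := γ (smoothStep t)
  smooth := γ.smooth.comp smoothStep_contDiff.contMDiff
  lazy := by
    obtain ⟨ε, hε, h0, h1⟩ := γ.lazy
    exact ⟨1 / 3, by norm_num, fun t ht => h0 _ (by rw [smoothStep_of_le ht]; exact hε.le),
      fun t ht => h1 _ (by rw [smoothStep_of_ge (by linarith)]; linarith)⟩

/-! Helper facts: the groupoid laws up to thin homotopy. -/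

lemma thin_of_factor {x y : M} {γ δ : LazyPath I x y} {c : ℝ → M}
    (hc : ContMDiff 𝓘(ℝ, ℝ) I ∞ c) {φ ψ : ℝ → ℝ} (hφ : ContDiff ℝ ∞ φ) (hψ : ContDiff ℝ ∞ ψ)
    (hγ : ∀ t, γ t = c (φ t)) (hδ : ∀ t, δ t = c (ψ t)) {ε : ℝ} (hε : 0 < ε)
    (h0 : ∀ t ≤ ε, ∀ r, 0 ≤ r → r ≤ 1 → c ((1 - r) * φ t + r * ψ t) = x)
    (h1 : ∀ t, 1 - ε ≤ t → ∀ r, 0 ≤ r → r ≤ 1 → c ((1 - r) * φ t + r * ψ t) = y) :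
    ThinHomotopic I γ δ := by
  have hm1 := min_le_left ε (1 / 3)
  have hm2 := min_le_right ε (1 / 3)
  have hs : ContDiff ℝ ∞ (fun p : ℝ × ℝ => smoothStep p.1) := smoothStep_contDiff.comp contDiff_fst
  refine ⟨_, IsThin.of_path hc
    (φ := fun p => (1 - smoothStep p.1) * φ p.2 + smoothStep p.1 * ψ p.2)
    (((contDiff_const.sub hs).mul (hφ.comp contDiff_snd)).add (hs.mul (hψ.comp contDiff_snd))),
    min ε (1 / 3), lt_min hε (by norm_num), ?_, ?_, ?_, ?_⟩
  · intro s t hs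
    simp only [smoothStep_of_le (show s ≤ 1 / 3 by linarith), hγ]
    congr 1; ring
  · intro s t hs
    simp only [smoothStep_of_ge (show 2 / 3 ≤ s by linarith), hδ]
    congr 1; ring
  · exact fun s t ht => h0 t (by linarith) _ (smoothStep_nonneg s) (smoothStep_le_one s)
  · exact fun s t ht => h1 t (by linarith) _ (smoothStep_nonneg s) (smoothStep_le_one s)

lemma thin_of_reparam {x y : M} {γ δ : LazyPath I x y} {φ : ℝ → ℝ} (hφ : ContDiff ℝ ∞ φ)
    (hδ : ∀ t, δ t = γ (φ t))
    (h : ∀ ε > 0, ∃ η > 0, (∀ t ≤ η, φ t ≤ ε) ∧ ∀ t, 1 - η ≤ t → 1 - ε ≤ φ t) :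
    ThinHomotopic I δ γ := by
  obtain ⟨ε, hε, h0, h1⟩ := γ.lazy
  obtain ⟨η, hη, k0, k1⟩ := h ε hε
  have hm1 := min_le_left ε η
  have hm2 := min_le_right ε η
  refine thin_of_factor γ.smooth hφ contDiff_id hδ (fun _ => rfl) (lt_min hε hη) ?_ ?_
  · intro t ht r hr hr'
    refine h0 _ ?_
    have := k0 t (by linarith)
    simp only [id]
    nlinarith [mul_le_mul_of_nonneg_left this (sub_nonneg.2 hr'),
      mul_le_mul_of_nonneg_left (show t ≤ ε by linarith) hr]
  · intro t ht r hr hr'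
    refine h1 _ ?_
    have := k1 t (by linarith)
    simp only [id]
    nlinarith [mul_le_mul_of_nonneg_left this (sub_nonneg.2 hr'),
      mul_le_mul_of_nonneg_left (show 1 - ε ≤ t by linarith) hr]

lemma thin_slow {x y : M} (γ : LazyPath I x y) : ThinHomotopic I γ.slow γ := by
  refine thin_of_reparam smoothStep_contDiff (fun _ => rfl) fun ε hε => ⟨1 / 3, by norm_num, ?_, ?_⟩
  · intro t ht
    rw [smoothStep_of_le ht]; exact hε.le
  · intro t ht
    rw [smoothStep_of_ge (by linarith)]; linarith

lemma thin_symm {x y : M} {γ δ : LazyPath I x y} (h : ThinHomotopic I γ δ) :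
    ThinHomotopic I γ.symm δ.symm := by
  obtain ⟨k, hk, ε, hε, h0, h1, h2, h3⟩ := h
  exact ⟨fun p => k (p.1, 1 - p.2),
    hk.comp (contDiff_fst.prodMk (contDiff_const.sub contDiff_snd)), ε, hε,
    fun s t hs => h0 _ _ hs, fun s t hs => h1 _ _ hs,
    fun s t ht => h3 _ _ (by linarith), fun s t ht => h2 _ _ (by linarith)⟩

lemma thin_trans {x y z : M} {γ γ' : LazyPath I x y} {δ δ' : LazyPath I y z}
    (h : ThinHomotopic I γ γ') (h' : ThinHomotopic I δ δ') :
    ThinHomotopic I (γ.trans δ) (γ'.trans δ') := by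
  obtain ⟨k, hk, ε, hε, h0, h1, h2, h3⟩ := h
  obtain ⟨k', hk', ε', hε', h0', h1', h2', h3'⟩ := h'
  have hm : 0 < min ε ε' := lt_min hε hε'
  have hm1 := min_le_left ε ε'
  have hm2 := min_le_right ε ε'
  have hm3 : 0 < min (min ε ε' / 2) (1 / 4) := lt_min (by linarith) (by norm_num)
  have hm4 := min_le_left (min ε ε' / 2) (1 / 4)
  have hm5 := min_le_right (min ε ε' / 2) (1 / 4)
  refine ⟨_, IsThin.glue
    (hk.comp (φ := fun p => (p.1, 2 * p.2))
      (contDiff_fst.prodMk (contDiff_const.mul contDiff_snd)))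
    (hk'.comp (φ := fun p => (p.1, 2 * p.2 - 1))
      (contDiff_fst.prodMk ((contDiff_const.mul contDiff_snd).sub contDiff_const)))
    (fun p => p.2) continuous_snd (min ε ε') hm ?_, min (min ε ε' / 2) (1 / 4), hm3, ?_, ?_, ?_, ?_⟩
  · intro p hp hp'
    exact (h3 _ _ (by linarith)).trans (h2' _ _ (by linarith)).symm
  · intro s t hs
    simp only [trans, h0 s _ (show s ≤ ε by linarith), h0' s _ (show s ≤ ε' by linarith)]
  · intro s t hs
    simp only [trans, h1 s _ (show 1 - ε ≤ s by linarith), h1' s _ (show 1 - ε' ≤ s by linarith)]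
  · intro s t ht
    simp only [show t ≤ 1 / 2 by linarith, if_true]
    exact h2 _ _ (by linarith)
  · intro s t ht
    simp only [show ¬ t ≤ 1 / 2 by linarith, if_false]
    exact h3' _ _ (by linarith)

lemma thin_refl_trans {x y : M} (γ : LazyPath I x y) :
    ThinHomotopic I ((LazyPath.refl I x).trans γ) γ := by
  obtain ⟨ε, hε, h0, h1⟩ := γ.lazy
  refine thin_of_reparam (φ := fun t => 2 * t - 1)
    ((contDiff_const.mul contDiff_id).sub contDiff_const) (fun t => ?_) fun ε hε => ?_
  · simp only [trans, refl]
    split_ifs with h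
    · exact (h0 _ (by linarith)).symm
    · rfl
  · refine ⟨min (ε / 2) (1 / 2), lt_min (by linarith) (by norm_num), ?_, ?_⟩
    · intro t ht
      have := min_le_right (ε / 2) (1 / 2)
      linarith
    · intro t ht
      have := min_le_left (ε / 2) (1 / 2)
      linarith

lemma thin_trans_refl {x y : M} (γ : LazyPath I x y) :
    ThinHomotopic I (γ.trans (LazyPath.refl I y)) γ := by
  obtain ⟨ε, hε, h0, h1⟩ := γ.lazy
  refine thin_of_reparam (φ := fun t => 2 * t)
    (contDiff_const.mul contDiff_id) (fun t => ?_) fun ε hε => ?_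
  · simp only [trans, refl]
    split_ifs with h
    · rfl
    · exact (h1 _ (by linarith)).symm
  · refine ⟨min (ε / 2) (1 / 2), lt_min (by linarith) (by norm_num), ?_, ?_⟩
    · intro t ht
      have := min_le_left (ε / 2) (1 / 2)
      linarith
    · intro t ht
      have := min_le_right (ε / 2) (1 / 2)
      linarith

lemma thin_assoc {w x y z : M} (a : LazyPath I w x) (b : LazyPath I x y) (c : LazyPath I y z) :
    ThinHomotopic I ((a.trans b).trans c) (a.trans (b.trans c)) := by
  refine (thin_trans (thin_trans a.thin_slow.symm b.thin_slow.symm) c.thin_slow.symm).trans ?_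
  have hσ := smoothStep_contDiff
  refine thin_of_reparam
    (φ := fun t => 1 / 2 * smoothStep (4 * t) + 1 / 4 * smoothStep (4 * t - 1)
      + 1 / 4 * smoothStep (2 * t - 1)) ?_ (fun t => ?_) fun ε hε => ⟨1 / 12, by norm_num, ?_, ?_⟩
  · exact ((contDiff_const.mul (hσ.comp (contDiff_const.mul contDiff_id))).add
      (contDiff_const.mul (hσ.comp ((contDiff_const.mul contDiff_id).sub contDiff_const)))).add
      (contDiff_const.mul (hσ.comp ((contDiff_const.mul contDiff_id).sub contDiff_const)))
  · obtain ⟨ε, hε, h0, h1⟩ := a.lazy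
    obtain ⟨ε', hε', h0', h1'⟩ := b.lazy
    obtain ⟨ε'', hε'', h0'', h1''⟩ := c.lazy
    rcases le_or_gt t (1 / 2) with ht | ht
    · rcases le_or_gt (2 * t) (1 / 2) with ht' | ht'
      · have e1 := smoothStep_of_le (show 4 * t - 1 ≤ 1 / 3 by linarith)
        have e2 := smoothStep_of_le (show 2 * t - 1 ≤ 1 / 3 by linarith)
        have e3 := smoothStep_le_one (4 * t)
        simp only [trans, slow, ht, ht', if_true, e1, e2]
        rw [if_pos (by linarith)]
        congr 1
        rw [show 2 * (2 * t) = 4 * t by ring]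
        ring
      · have e1 := smoothStep_of_ge (show 2 / 3 ≤ 4 * t by linarith)
        have e2 := smoothStep_of_le (show 2 * t - 1 ≤ 1 / 3 by linarith)
        have e3 := smoothStep_le_one (4 * t - 1)
        have e4 := smoothStep_nonneg (4 * t - 1)
        simp only [trans, slow, ht, not_le.2 ht', if_true, if_false, e1, e2]
        rw [show 2 * (2 * t) - 1 = 4 * t - 1 by ring]
        rcases e4.eq_or_lt with e5 | e5
        · rw [← e5, if_pos (by norm_num), h0' 0 hε'.le, h1 _ (by linarith)]
        · rw [if_neg (by linarith), if_pos (by linarith)]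
          congr 1
          ring
    · have e1 := smoothStep_of_ge (show 2 / 3 ≤ 4 * t by linarith)
      have e2 := smoothStep_of_ge (show 2 / 3 ≤ 4 * t - 1 by linarith)
      have e4 := smoothStep_nonneg (2 * t - 1)
      simp only [trans, slow, not_le.2 ht, if_false, e1, e2]
      rw [if_neg (by linarith)]
      rcases e4.eq_or_lt with e5 | e5
      · rw [← e5, if_pos (by norm_num), h0'' 0 hε''.le, h1' _ (by linarith)]
      · rw [if_neg (by linarith)]
        congr 1
        ring
  · intro t ht
    rw [smoothStep_of_le (show 4 * t ≤ 1 / 3 by linarith),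
      smoothStep_of_le (show 4 * t - 1 ≤ 1 / 3 by linarith),
      smoothStep_of_le (show 2 * t - 1 ≤ 1 / 3 by linarith)]
    linarith
  · intro t ht
    rw [smoothStep_of_ge (show 2 / 3 ≤ 4 * t by linarith),
      smoothStep_of_ge (show 2 / 3 ≤ 4 * t - 1 by linarith),
      smoothStep_of_ge (show 2 / 3 ≤ 2 * t - 1 by linarith)]
    linarith

lemma thin_trans_symm {x y : M} (γ : LazyPath I x y) :
    ThinHomotopic I (γ.trans γ.symm) (LazyPath.refl I x) := by
  refine (thin_trans γ.thin_slow.symm γ.symm.thin_slow.symm).trans ?_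
  have hσ := smoothStep_contDiff
  obtain ⟨ε, hε, h0, h1⟩ := γ.lazy
  refine thin_of_factor (c := γ) (φ := fun t => smoothStep (2 * t) - smoothStep (2 * t - 1))
    (ψ := fun _ => 0) γ.smooth ?_ contDiff_const (fun t => ?_) (fun t => (h0 0 hε.le).symm)
    (show (0 : ℝ) < 1 / 6 by norm_num) ?_ ?_
  · exact (hσ.comp (contDiff_const.mul contDiff_id)).sub
      (hσ.comp ((contDiff_const.mul contDiff_id).sub contDiff_const))
  · rcases le_or_gt t (1 / 2) with ht | ht
    · simp only [trans, slow, ht, if_true, smoothStep_of_le (show 2 * t - 1 ≤ 1 / 3 by linarith),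
        sub_zero]
    · simp only [trans, slow, symm, not_le.2 ht, if_false,
        smoothStep_of_ge (show 2 / 3 ≤ 2 * t by linarith)]
  · intro t ht r _ _
    refine h0 _ ?_
    rw [smoothStep_of_le (show 2 * t ≤ 1 / 3 by linarith),
      smoothStep_of_le (show 2 * t - 1 ≤ 1 / 3 by linarith)]
    linarith
  · intro t ht r _ _
    refine h0 _ ?_
    rw [smoothStep_of_ge (show 2 / 3 ≤ 2 * t by linarith),
      smoothStep_of_ge (show 2 / 3 ≤ 2 * t - 1 by linarith)]
    linarith

lemma symm_symm {x y : M} (γ : LazyPath I x y) : γ.symm.symm = γ := by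
  cases γ with
  | mk f h l => simp [symm]

lemma thin_symm_trans {x y : M} (γ : LazyPath I x y) :
    ThinHomotopic I (γ.symm.trans γ) (LazyPath.refl I y) := by
  have h := thin_trans_symm γ.symm
  rwa [symm_symm] at h

end LazyPath

/-! ### The path groupoid -/

/-- The objects of the path groupoid of `M`: the points of `M`. -/
@[ext]
structure PathGroupoid (I : ModelWithCorners ℝ E H) (M : Type*) [TopologicalSpace M]
    [ChartedSpace H M] where
  /-- The underlying point. -/
  as : M

/-- The path groupoid: morphisms `x ⟶ y` are the thin homotopy classes of paths from `x` to `y`,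
and `f ≫ g` is the class of `f` followed by `g`. -/
instance : CategoryTheory.Groupoid (PathGroupoid I M) where
  Hom x y := Quotient (thinSetoid I x.as y.as)
  id x := Quotient.mk _ (LazyPath.refl I x.as)
  comp f g := Quotient.map₂ LazyPath.trans
    (fun _ _ h _ _ h' => LazyPath.thin_trans h h') f g
  inv f := Quotient.map LazyPath.symm (fun _ _ h => LazyPath.thin_symm h) f
  id_comp f := Quotient.inductionOn f fun γ => Quotient.sound γ.thin_refl_trans
  comp_id f := Quotient.inductionOn f fun γ => Quotient.sound γ.thin_trans_refl
  assoc f g h := Quotient.inductionOn₃ f g h fun a b c => Quotient.sound (a.thin_assoc b c)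
  inv_comp f := Quotient.inductionOn f fun γ => Quotient.sound γ.thin_symm_trans
  comp_inv f := Quotient.inductionOn f fun γ => Quotient.sound γ.thin_trans_symm

/-- The morphism of the path groupoid represented by a path. -/
def LazyPath.toHom {x y : M} (γ : LazyPath I x y) :
    (⟨x⟩ : PathGroupoid I M) ⟶ (⟨y⟩ : PathGroupoid I M) :=
  Quotient.mk (thinSetoid I x y) γ

end Paths

section Gauge

open CategoryTheory

variable {E : Type*} [NormedAddCommGroup E] [NormedSpace ℝ E]
  {H : Type*} [TopologicalSpace H] (I : ModelWithCorners ℝ E H)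
  (M : Type*) [TopologicalSpace M] [ChartedSpace H M]
  {E' : Type*} [NormedAddCommGroup E'] [NormedSpace ℝ E']
  {H' : Type*} [TopologicalSpace H'] (J : ModelWithCorners ℝ E' H')
  (G : Type*) [TopologicalSpace G] [ChartedSpace H' G] [Group G]

/-! ### Smooth functors to a Lie group -/

variable {I M G} in
/-- The group element that a functor from the path groupoid to the one-object groupoid of `G`
assigns to (the thin homotopy class of) a path. The composition in `SingleObj G` is
`g ≫ h = h * g`, so that the path "first `γ`, then `δ`" is sent to `hol δ * hol γ`. -/
def holonomy (F : PathGroupoid I M ⥤ SingleObj G) {x y : M} (γ : LazyPath I x y) : G :=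
  F.map γ.toHom

variable {I M G} in
/-- Smoothness of a functor for the quotient diffeology on the set of all morphisms of the path
groupoid: for every smoothly parametrized family of paths `c u`, with parameter `u` in an open set
`U` of some `ℝ^k` (smooth meaning that `(u, t) ↦ c u t` is smooth; the end points of `c u` may
vary with `u`), the map from `U` to `G` sending `u` to the value of `F` on `c u` is smooth. -/
def IsSmoothFunctor (F : PathGroupoid I M ⥤ SingleObj G) : Prop :=
  ∀ (k : ℕ) (U : Set (EuclideanSpace ℝ (Fin k))), IsOpen U →
    ∀ (x y : EuclideanSpace ℝ (Fin k) → M) (c : ∀ u, LazyPath I (x u) (y u)),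
      ContMDiffOn 𝓘(ℝ, EuclideanSpace ℝ (Fin k) × ℝ) I ∞
        (fun p : EuclideanSpace ℝ (Fin k) × ℝ => c p.1 p.2) (U ×ˢ Set.univ) →
      ContMDiffOn 𝓘(ℝ, EuclideanSpace ℝ (Fin k)) J ∞ (fun u => holonomy F (c u)) U

/-- Smooth functors from the path groupoid of `M` to `G`, viewed as a one-object groupoid. -/
def SmoothFunctor : Type _ :=
  {F : PathGroupoid I M ⥤ SingleObj G // IsSmoothFunctor J F}

/-! ### Connections on the trivial bundle and parallel transport -/

/-- A connection on the trivial `G`-bundle over `M`: a smooth 1-form on `M` with values in the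
Lie algebra of `G`, smoothness being that of the associated map from the tangent bundle of `M` to
the vector space `T_1 G` (whose model space is `E'`). -/
@[ext]
structure TrivialBundleConnection [IsManifold I 1 M] where
  /-- The 1-form. -/
  form : ∀ x : M, TangentSpace I x →L[ℝ] GroupLieAlgebra J G
  smooth : ContMDiff (M' := E') I.tangent 𝓘(ℝ, E') ∞
    (fun p : TangentBundle I M => form p.proj p.snd)

variable {I M J G} [IsManifold I 1 M] in
/-- `g` is the parallel transport of `A` along `γ`: the differentiable solution of
`g' = A(γ') g`, `g 0 = 1`, where the product `A(γ' t) g(t)` is the image of `A(γ' t) ∈ T_1 G` under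
the differential of the right translation by `g t`; the equation is one between elements of the
tangent bundle of `G`. The value `g 1` is the path-ordered exponential of `A` along `γ`. -/
def IsParallelTransport (A : TrivialBundleConnection I M J G) {x y : M} (γ : LazyPath I x y)
    (g : ℝ → G) : Prop :=
  MDifferentiable 𝓘(ℝ, ℝ) J g ∧ g 0 = 1 ∧
    ∀ t : ℝ, tangentMap 𝓘(ℝ, ℝ) J g ⟨t, (1 : ℝ)⟩ =
      tangentMap J J (fun a : G => a * g t)
        ⟨1, A.form (γ t) (mfderiv 𝓘(ℝ, ℝ) I γ t (1 : ℝ))⟩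

end Gauge

end

/-! Everything rests on the equation g' = ξ g in G. A curve is described by its right logarithmic
derivative (`HasRightLogDerivAt`), which does not change under right translation by a constant. So
two solutions on an interval differ by a constant right factor (`eqOn_of_hasRightLogDerivAt`), local
solutions can be translated and glued, and a smooth ξ on the line always has a global solution
(`exists_evolution`). For small ξ, smooth dependence on ξ is the implicit function theorem in a
Banach space of continuous curves (`exists_contDiffAt_solution`); rescaling short time intervals to
a fixed one spreads it over all times (`contMDiff_evolution`).

Parallel transport is the case ξ = A(γ'). Uniqueness makes it compatible with reparametrization and
concatenation. For thin invariance (`transport_eq_of_thinHomotopic`), let g(s,t) be the transport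
along the curves h(s,·) of a thin homotopy, ξ the logarithmic derivative of g in s, and a, b the two
components of the pull-back of A by h. The Maurer-Cartan equation expresses ∂ξ/∂t by ∂b/∂s and a
bracket of ξ and b. Since h has rank less than two, the pulled-back form is closed and the bracket
of a and b vanishes, so ξ - a solves a homogeneous linear equation in t with initial value 0. Hence
ξ = a, and at t = 1 both vanish because the end point is fixed: g(·,1) is constant.

Conversely, a smooth functor evaluated on the images of straight segments under a parametrization of
M is a smooth function of base point and direction, equal to 1 on the zero segment; its derivative
in the direction is the form, linear by construction. Hadamard's lemma compares a general curve with
segments (`hasRightLogDerivAt_holonomy_ofCurve`): to first order the holonomy depends only on the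
velocity. This gives independence of the chart, and with it smoothness of the form.

The constructions are mutually inverse because the holonomy along growing pieces of a curve, by
functoriality, solves the transport equation of the extracted form (`holonomy_eq_transport`), while
the transport of A has derivative A(c'(0)) at time 0. -/

noncomputable section

/-! ### Calculus in Banach spaces of continuous maps. -/

section Analysis

open Set Filter Topology

/-! ### Globalizing local data -/

/-- A smooth self-map of a finite-dimensional space with values in a given neighbourhood of a point
that is the identity near that point. -/
lemma exists_contDiff_eventuallyEq_id {E : Type*} [NormedAddCommGroup E] [NormedSpace ℝ E]
    [FiniteDimensional ℝ E] {x₀ : E} {U : Set E} (hU : U ∈ 𝓝 x₀) :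
    ∃ ρ : E → E, ContDiff ℝ ∞ ρ ∧ ρ =ᶠ[𝓝 x₀] id ∧ ∀ x, ρ x ∈ U := by
  obtain ⟨r, hr, hrU⟩ := Metric.mem_nhds_iff.1 hU
  let χ : ContDiffBump x₀ := ⟨r / 3, r / 2, by positivity, by linarith⟩
  refine ⟨fun x => x₀ + χ x • (x - x₀),
    contDiff_const.add (χ.contDiff.smul (contDiff_id.sub contDiff_const)), ?_, fun x => hrU ?_⟩
  · filter_upwards [χ.eventuallyEq_one] with x hx
    simp [hx]
  · rw [Metric.mem_ball, dist_eq_norm, add_sub_cancel_left, norm_smul, Real.norm_eq_abs,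
      abs_of_nonneg χ.nonneg]
    by_cases hx : x ∈ Metric.ball x₀ (r / 2)
    · rw [mem_ball_iff_norm] at hx
      calc χ x * ‖x - x₀‖ ≤ 1 * ‖x - x₀‖ := by gcongr; exact χ.le_one
        _ < r := by linarith
    · have : χ x = 0 := by
        rw [← Function.notMem_support, χ.support_eq]
        exact hx
      rw [this, zero_mul]
      exact hr

/-! ### Superposition operators -/

section Superposition

variable {K : Type*} [TopologicalSpace K] [CompactSpace K]

/-- Pointwise application of a continuous family of linear maps, as a bilinear map. -/
def pointwiseApply (K : Type*) [TopologicalSpace K] [CompactSpace K]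
    (E F : Type*) [NormedAddCommGroup E] [NormedSpace ℝ E] [NormedAddCommGroup F]
    [NormedSpace ℝ F] : C(K, E →L[ℝ] F) →L[ℝ] C(K, E) →L[ℝ] C(K, F) :=
  LinearMap.mkContinuous₂
    (LinearMap.mk₂ ℝ (fun (L : C(K, E →L[ℝ] F)) (x : C(K, E)) =>
      (⟨fun t => L t (x t), L.continuous.clm_apply x.continuous⟩ : C(K, F)))
      (fun _ _ _ => by ext; simp) (fun _ _ _ => by ext; simp)
      (fun _ _ _ => by ext; simp) (fun _ _ _ => by ext; simp)) 1 (fun L x => by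
      rw [one_mul]
      refine (ContinuousMap.norm_le _ (by positivity)).2 fun t => ?_
      exact ((L t).le_opNorm _).trans
        (by gcongr; exacts [L.norm_coe_le_norm t, x.norm_coe_le_norm t]))

@[simp] lemma pointwiseApply_apply {E F : Type*} [NormedAddCommGroup E] [NormedSpace ℝ E]
    [NormedAddCommGroup F] [NormedSpace ℝ F] (L : C(K, E →L[ℝ] F)) (x : C(K, E)) (t : K) :
    pointwiseApply K E F L x t = L t (x t) := rfl

/-- Postcomposition with `fderiv ℝ f` is continuous in the sup norm, so `fderiv ℝ f` varies by at
most ε along the segment from `x t` to `x t + h t`, uniformly in t, once h is small. The mean value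
inequality then bounds the remainder by ε‖h‖ at every t. -/
lemma hasFDerivAt_comp_left {E F : Type*} [NormedAddCommGroup E] [NormedSpace ℝ E]
    [NormedAddCommGroup F] [NormedSpace ℝ F] {f : E → F} (hf : ContDiff ℝ 1 f) (x : C(K, E)) :
    HasFDerivAt (fun y : C(K, E) => (⟨f, hf.continuous⟩ : C(E, F)).comp y)
      (pointwiseApply K E F ((⟨fderiv ℝ f, hf.continuous_fderiv one_ne_zero⟩ :
        C(E, E →L[ℝ] F)).comp x)) x := by
  rw [hasFDerivAt_iff_isLittleO_nhds_zero, Asymptotics.isLittleO_iff]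
  intro ε hε
  have hcont := ((⟨fderiv ℝ f, hf.continuous_fderiv one_ne_zero⟩ :
    C(E, E →L[ℝ] F)).continuous_postcomp (X := K)).continuousAt (x := x)
  obtain ⟨δ, hδ, hδ'⟩ := (Metric.continuousAt_iff (α := C(K, E))
    (β := C(K, E →L[ℝ] F))).1 hcont ε hε
  filter_upwards [Metric.ball_mem_nhds (0 : C(K, E)) hδ] with h hh
  rw [mem_ball_zero_iff] at hh
  refine (ContinuousMap.norm_le _ (by positivity)).2 fun t => ?_
  have key : ∀ z ∈ segment ℝ (x t) (x t + h t), ‖fderiv ℝ f z - fderiv ℝ f (x t)‖ ≤ ε := by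
    intro z hz
    rw [segment_eq_image'] at hz
    obtain ⟨θ, hθ, rfl⟩ := hz
    have h1 : dist (x + θ • h) x < δ := by
      rw [dist_eq_norm, add_sub_cancel_left, norm_smul, Real.norm_eq_abs, abs_of_nonneg hθ.1]
      nlinarith [hθ.2, norm_nonneg h]
    have h2 := (ContinuousMap.dist_apply_le_dist t).trans (hδ' h1).le
    rw [dist_eq_norm] at h2
    simpa using h2
  have := (convex_segment (x t) (x t + h t)).norm_image_sub_le_of_norm_fderiv_le'
    (f := f) (fun z _ => (hf.differentiable one_ne_zero) z) key
    (left_mem_segment ℝ _ _) (right_mem_segment ℝ _ _)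
  simp only [add_sub_cancel_left] at this
  refine (this.trans ?_)
  gcongr
  exact h.norm_coe_le_norm t

universe u v

/-- Induction on the order: the derivative is again a superposition operator, that of `fderiv ℝ f`,
followed by the bounded bilinear `pointwiseApply`. The universe of F absorbs that of E so that the
induction can pass from F to `E →L[ℝ] F`. -/
lemma contDiff_comp_left {E : Type u} {F : Type (max u v)} [NormedAddCommGroup E]
    [NormedSpace ℝ E] [NormedAddCommGroup F] [NormedSpace ℝ F] {f : E → F}
    (hf : ContDiff ℝ ∞ f) :
    ContDiff ℝ ∞ (fun y : C(K, E) => (⟨f, hf.continuous⟩ : C(E, F)).comp y) := by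
  rw [contDiff_infty]
  intro n
  induction n generalizing F with
  | zero =>
    exact contDiff_zero.2 (ContinuousMap.continuous_postcomp _)
  | succ n ih =>
    have h1 : ContDiff ℝ 1 f := hf.of_le (by exact_mod_cast le_top)
    have h2 : ContDiff ℝ ∞ (fderiv ℝ f) := hf.fderiv_right (by simp)
    rw [show ((n + 1 : ℕ) : WithTop ℕ∞) = n + 1 by simp, contDiff_succ_iff_hasFDerivAt]
    · refine ⟨_, ?_, fun x => hasFDerivAt_comp_left h1 x⟩
      exact (pointwiseApply K E F).contDiff.comp (ih h2)

end Superposition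

end Analysis
end

noncomputable section

/-! ### Differential equations as equations between curves on a compact interval. -/

section Analysis

open Set Filter Topology

universe v

/-! ### Curves on a fixed compact interval -/

/-- The compact time interval on which local solutions are constructed. -/
abbrev TimeInterval : Type := Icc (-2 : ℝ) 2

/-- The continuous function on `TimeInterval` given by restricting a function on `ℝ`. -/
def restrictTime {F : Type*} [TopologicalSpace F] (a : ℝ → F) (ha : Continuous a) :
    C(TimeInterval, F) := ⟨fun t => a t, ha.comp continuous_subtype_val⟩

@[simp] lemma restrictTime_apply {F : Type*} [TopologicalSpace F] (a : ℝ → F) (ha : Continuous a)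
    (t : TimeInterval) : restrictTime a ha t = a t := rfl

/-- The curve of w is the superposition operator of b applied to t ↦ (w, t), and the latter is
affine in w, with linear part w ↦ (w, 0). -/
lemma contDiff_restrictTime {W : Type} {F : Type v} [NormedAddCommGroup W] [NormedSpace ℝ W]
    [NormedAddCommGroup F] [NormedSpace ℝ F] {b : W × ℝ → F} (hb : ContDiff ℝ ∞ b) :
    ContDiff ℝ ∞ (fun w => restrictTime (fun t => b (w, t))
      (hb.continuous.comp (Continuous.prodMk_right w))) := by
  let L : W →L[ℝ] C(TimeInterval, W × ℝ) :=
    LinearMap.mkContinuous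
      { toFun := fun w => ContinuousMap.const TimeInterval ((w, 0) : W × ℝ)
        map_add' := fun w w' => by ext t <;> simp
        map_smul' := fun r w => by ext t <;> simp } 1 fun w => by
      rw [one_mul]
      refine (ContinuousMap.norm_le _ (norm_nonneg _)).2 fun t => ?_
      simp [Prod.norm_def]
  have hc : ContDiff ℝ ∞ (fun w => L w + restrictTime (fun t => ((0, t) : W × ℝ))
      (Continuous.prodMk_right 0)) := L.contDiff.add contDiff_const
  convert (contDiff_comp_left.{0, v} (K := TimeInterval) hb).comp hc using 1
  funext w
  ext t
  simp [L]

/-- The primitive vanishing at `0`, as a continuous linear map. -/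
def primitive (F : Type*) [NormedAddCommGroup F] [NormedSpace ℝ F] :
    C(TimeInterval, F) →L[ℝ] C(TimeInterval, F) :=
  have h2 : (-2 : ℝ) ≤ 2 := by norm_num
  have hc (y : C(TimeInterval, F)) : Continuous (IccExtend h2 y) :=
    y.continuous.Icc_extend'
  LinearMap.mkContinuous
    { toFun := fun y => restrictTime (fun t => ∫ s in (0 : ℝ)..t, IccExtend h2 y s)
        (intervalIntegral.continuous_primitive (fun a b => (hc y).intervalIntegrable a b) 0)
      map_add' := fun y z => by
        ext t
        exact intervalIntegral.integral_add ((hc y).intervalIntegrable _ _)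
          ((hc z).intervalIntegrable _ _)
      map_smul' := fun r y => by
        ext t
        exact intervalIntegral.integral_smul r _ } 2 fun y => by
    refine (ContinuousMap.norm_le _ (by positivity)).2 fun t => ?_
    have h := intervalIntegral.norm_integral_le_of_norm_le_const (a := 0) (b := (t : ℝ))
      (f := IccExtend h2 y) (C := ‖y‖) fun s _ => y.norm_coe_le_norm _
    have ht : |(t : ℝ) - 0| ≤ 2 := by rw [sub_zero]; exact abs_le.2 t.2
    calc _ ≤ ‖y‖ * |(t : ℝ) - 0| := h
      _ ≤ ‖y‖ * 2 := by gcongr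
      _ = 2 * ‖y‖ := mul_comm _ _

lemma primitive_apply {F : Type*} [NormedAddCommGroup F] [NormedSpace ℝ F]
    (y : C(TimeInterval, F)) (t : TimeInterval) :
    primitive F y t = ∫ s in (0 : ℝ)..t, IccExtend (by norm_num : (-2 : ℝ) ≤ 2) y s := rfl

/-- Hadamard's lemma for curves. -/
lemma exists_contDiff_eq_add_smul {F : Type v} [NormedAddCommGroup F] [NormedSpace ℝ F]
    [CompleteSpace F] {c : ℝ → F} (hc : ContDiff ℝ ∞ c) :
    ∃ w : ℝ → F, ContDiff ℝ ∞ w ∧ w 0 = deriv c 0 ∧ ∀ s, c s = c 0 + s • w s := by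
  have hd : ContDiff ℝ ∞ (deriv c) := ((contDiff_succ_iff_deriv (n := ∞)).1 (by simpa using hc)).2.2
  -- The factor is w(s) = ∫₀¹ c'(st) dt. Writing it as the value at 1 of a primitive reduces its
  -- smoothness to that of a parametrized curve and of continuous linear maps.
  have hb : ContDiff ℝ ∞ (fun p : ℝ × ℝ => deriv c (p.1 * p.2)) :=
    hd.comp (contDiff_fst.mul contDiff_snd)
  let y : ℝ → C(TimeInterval, F) := fun w => restrictTime (fun t => deriv c (w * t))
      (hb.continuous.comp (Continuous.prodMk_right w))
  have hy : ContDiff ℝ ∞ y := contDiff_restrictTime hb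
  have h1 : (1 : ℝ) ∈ Icc (-2 : ℝ) 2 := by constructor <;> norm_num
  have hw : ∀ s, primitive F (y s) ⟨1, h1⟩ = ∫ t in (0 : ℝ)..1, deriv c (s * t) := by
    intro s
    rw [primitive_apply]
    refine intervalIntegral.integral_congr fun t ht => ?_
    rw [uIcc_of_le zero_le_one] at ht
    rw [IccExtend_of_mem _ _ (show t ∈ Icc (-2 : ℝ) 2 from
      ⟨by linarith [ht.1], by linarith [ht.2]⟩)]
    rfl
  refine ⟨fun s => primitive F (y s) ⟨1, h1⟩, ?_, ?_, fun s => ?_⟩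
  · exact (ContinuousMap.evalCLM ℝ (⟨1, h1⟩ : TimeInterval)).contDiff.comp
      ((primitive F).contDiff.comp hy)
  · simp [hw]
  · dsimp only
    rw [hw, intervalIntegral.smul_integral_comp_mul_left, mul_zero, mul_one,
      intervalIntegral.integral_deriv_eq_sub
        (fun x _ => (hc.differentiable (by simp)) x) (hd.continuous.intervalIntegrable _ _)]
    abel

/-- Local solvability of `x' = R(x) α`, `x(0) = p₀`, with smooth dependence on the small
control `α`. -/
lemma exists_contDiffAt_solution {F : Type v} [NormedAddCommGroup F] [NormedSpace ℝ F]
    [CompleteSpace F] {R : F → F →L[ℝ] F} (hR : ContDiff ℝ ∞ R) (p₀ : F) :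
    ∃ S : C(TimeInterval, F) → C(TimeInterval, F), ContDiffAt ℝ ∞ S 0 ∧
      S 0 = ContinuousMap.const _ p₀ ∧
      ∀ᶠ α in 𝓝 0, S α = ContinuousMap.const _ p₀ +
        primitive F
          (pointwiseApply _ F F ((⟨R, hR.continuous⟩ : C(F, F →L[ℝ] F)).comp (S α)) α) := by
  -- The equation in integrated form reads f(α, x) = p₀. At α = 0 the map f(0, ·) is the identity,
  -- so the partial derivative in x is invertible and the implicit function theorem applies.
  let f : C(TimeInterval, F) × C(TimeInterval, F) → C(TimeInterval, F) := fun p =>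
    p.2 - primitive F (pointwiseApply _ F F ((⟨R, hR.continuous⟩ : C(F, F →L[ℝ] F)).comp p.2) p.1)
  let u : C(TimeInterval, F) × C(TimeInterval, F) := (0, ContinuousMap.const _ p₀)
  have hf : ContDiff ℝ ∞ f := by
    have h1 : ContDiff ℝ ∞ (fun p : C(TimeInterval, F) × C(TimeInterval, F) =>
        pointwiseApply _ F F ((⟨R, hR.continuous⟩ : C(F, F →L[ℝ] F)).comp p.2)) :=
      ContDiff.comp (g := fun L => pointwiseApply TimeInterval F F L)
        (by fun_prop)
        ((contDiff_comp_left.{v, v} (K := TimeInterval) hR).comp contDiff_snd)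
    exact contDiff_snd.sub ((primitive F).contDiff.comp (h1.clm_apply contDiff_fst))
  have hfu : f u = ContinuousMap.const _ p₀ := by simp [f, u]
  have hd : fderiv ℝ f u ∘L .inr ℝ _ _ = ContinuousLinearMap.id ℝ _ := by
    have h1 : HasFDerivAt (fun x => f (0, x)) (fderiv ℝ f u ∘L .inr ℝ _ _)
        (ContinuousMap.const TimeInterval p₀) :=
      ((hf.differentiable (by simp)) u).hasFDerivAt.comp (ContinuousMap.const TimeInterval p₀)
        (hasFDerivAt_prodMk_right (0 : C(TimeInterval, F)) (ContinuousMap.const TimeInterval p₀))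
    have h2 : (fun x => f (0, x)) = id := by
      funext x
      simp [f]
    rw [h2] at h1
    exact h1.unique (hasFDerivAt_id _)
  have hinv : (fderiv ℝ f u ∘L .inr ℝ _ _).IsInvertible := by
    rw [hd]
    exact ⟨ContinuousLinearEquiv.refl ℝ _, rfl⟩
  have cdf := hf.contDiffAt (x := u)
  refine ⟨cdf.implicitFunction (by simp) hinv, cdf.contDiffAt_implicitFunction (by simp) hinv,
    cdf.implicitFunction_apply_self (by simp) hinv, ?_⟩
  filter_upwards [cdf.eventually_apply_implicitFunction (by simp) hinv] with α hα
  rw [hfu] at hα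
  exact sub_eq_iff_eq_add.1 hα

/-- The fundamental theorem of calculus. The end points are excluded because `IccExtend` continues x
by constants beyond them. -/
lemma hasDerivAt_of_eq_primitive {F : Type*} [NormedAddCommGroup F] [NormedSpace ℝ F]
    [CompleteSpace F] {x y : C(TimeInterval, F)} {p₀ : F}
    (h : x = ContinuousMap.const _ p₀ + primitive F y) {t : ℝ} (ht : t ∈ Ioo (-2 : ℝ) 2) :
    HasDerivAt (IccExtend (by norm_num : (-2 : ℝ) ≤ 2) x) (y ⟨t, Ioo_subset_Icc_self ht⟩) t := by
  have h2 : (-2 : ℝ) ≤ 2 := by norm_num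
  have hc : Continuous (IccExtend h2 y) := y.continuous.Icc_extend'
  have h1 : HasDerivAt (fun t => p₀ + ∫ s in (0 : ℝ)..t, IccExtend h2 y s) (IccExtend h2 y t) t :=
    (intervalIntegral.integral_hasDerivAt_right (hc.intervalIntegrable _ _)
      (hc.stronglyMeasurableAtFilter _ _) hc.continuousAt).const_add p₀
  rw [IccExtend_of_mem _ _ (Ioo_subset_Icc_self ht)] at h1
  refine h1.congr_of_eventuallyEq ?_
  filter_upwards [Ioo_mem_nhds ht.1 ht.2] with s hs
  rw [IccExtend_of_mem _ _ (Ioo_subset_Icc_self hs), h]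
  rfl

end Analysis
end

noncomputable section

/-! ### Right logarithmic derivatives of curves in a Lie group, and uniqueness for g' = a g. -/

section RightLogDeriv

open Set Filter Topology

variable {E' : Type*} [NormedAddCommGroup E'] [NormedSpace ℝ E']
  {G : Type*} [TopologicalSpace G] [ChartedSpace E' G]

/-! ### The chart at the identity -/

variable (E' G) in
/-- The preferred chart at the identity. -/
abbrev chartOne [One G] : PartialEquiv G E' := extChartAt 𝓘(ℝ, E') (1 : G)

section ChartOne

variable [One G]

lemma isOpen_chartOne_source : IsOpen (chartOne E' G).source := isOpen_extChartAt_source _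

lemma isOpen_chartOne_target : IsOpen (chartOne E' G).target := isOpen_extChartAt_target _

lemma one_mem_chartOne_source : (1 : G) ∈ (chartOne E' G).source := mem_extChartAt_source _

lemma chartOne_one_mem_target : chartOne E' G 1 ∈ (chartOne E' G).target :=
  mem_extChartAt_target _

@[simp] lemma chartOne_symm_chartOne_one : (chartOne E' G).symm (chartOne E' G 1) = 1 :=
  extChartAt_to_inv _

lemma contMDiffAt_chartOne [IsManifold 𝓘(ℝ, E') ∞ G] {x : G} (hx : x ∈ (chartOne E' G).source) :
    ContMDiffAt 𝓘(ℝ, E') 𝓘(ℝ, E') ∞ (chartOne E' G) x :=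
  contMDiffAt_extChartAt' (by simpa using hx)

lemma contMDiffAt_chartOne_symm [IsManifold 𝓘(ℝ, E') ∞ G] {y : E'}
    (hy : y ∈ (chartOne E' G).target) :
    ContMDiffAt 𝓘(ℝ, E') 𝓘(ℝ, E') ∞ (chartOne E' G).symm y :=
  (contMDiffOn_extChartAt_symm _).contMDiffAt (isOpen_chartOne_target.mem_nhds hy)

lemma contDiffAt_comp_chartOne_symm [IsManifold 𝓘(ℝ, E') ∞ G] {F : Type*} [NormedAddCommGroup F]
    [NormedSpace ℝ F] {f : G → F} {y : E'} (hy : y ∈ (chartOne E' G).target)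
    (hf : ContMDiffAt 𝓘(ℝ, E') 𝓘(ℝ, F) ∞ f ((chartOne E' G).symm y)) :
    ContDiffAt ℝ ∞ (fun z => f ((chartOne E' G).symm z)) y :=
  (hf.comp y (contMDiffAt_chartOne_symm hy)).contDiffAt

lemma hasDerivAt_comp_of_chartOne [IsManifold 𝓘(ℝ, E') ∞ G] {F : Type*} [NormedAddCommGroup F]
    [NormedSpace ℝ F] {f : G → F} {X : ℝ → G} {t : ℝ} {v : E'} (hX : ContinuousAt X t)
    (hs : X t ∈ (chartOne E' G).source)
    (hv : HasDerivAt (fun s => chartOne E' G (X s)) v t)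
    (hf : ContMDiffAt 𝓘(ℝ, E') 𝓘(ℝ, F) ∞ f (X t)) :
    HasDerivAt (fun s => f (X s))
      (fderiv ℝ (fun y => f ((chartOne E' G).symm y)) (chartOne E' G (X t)) v) t := by
  have h1 : ContDiffAt ℝ ∞ (fun y => f ((chartOne E' G).symm y)) (chartOne E' G (X t)) :=
    contDiffAt_comp_chartOne_symm ((chartOne E' G).map_source hs)
      (by rwa [(chartOne E' G).left_inv hs])
  refine ((h1.differentiableAt (by simp)).hasFDerivAt.comp_hasDerivAt t hv).congr_of_eventuallyEq ?_
  filter_upwards [hX.preimage_mem_nhds (isOpen_chartOne_source.mem_nhds hs)] with s hs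
  simp only [Function.comp_apply]
  rw [(chartOne E' G).left_inv hs]

end ChartOne

variable [Group G]

/-! ### Right logarithmic derivatives -/

/-- The curve `g` has right logarithmic derivative `ξ` at `t`, that is, `g' t = ξ g(t)`; the
derivative of `s ↦ g s * (g t)⁻¹` is taken in the chart at the identity. -/
def HasRightLogDerivAt (g : ℝ → G) (ξ : E') (t : ℝ) : Prop :=
  ContinuousAt g t ∧ HasDerivAt (fun s => chartOne E' G (g s * (g t)⁻¹)) ξ t

lemma HasRightLogDerivAt.mul_const [ContinuousMul G] {g : ℝ → G} {ξ : E'} {t : ℝ}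
    (h : HasRightLogDerivAt g ξ t) (k : G) : HasRightLogDerivAt (fun s => g s * k) ξ t := by
  refine ⟨h.1.mul continuousAt_const, ?_⟩
  convert h.2 using 3
  group

lemma HasRightLogDerivAt.congr {g k : ℝ → G} {ξ : E'} {t : ℝ} (h : HasRightLogDerivAt g ξ t)
    (hk : k =ᶠ[𝓝 t] g) : HasRightLogDerivAt k ξ t := by
  refine ⟨h.1.congr hk.symm, h.2.congr_of_eventuallyEq ?_⟩
  filter_upwards [hk] with s hs
  rw [hs, hk.eq_of_nhds]

lemma HasRightLogDerivAt.scomp {g : ℝ → G} {ξ : E'} {φ : ℝ → ℝ} {c t : ℝ}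
    (h : HasRightLogDerivAt g ξ (φ t)) (hφ : HasDerivAt φ c t) :
    HasRightLogDerivAt (fun s => g (φ s)) (c • ξ) t :=
  ⟨ContinuousAt.comp (f := φ) h.1 hφ.continuousAt, h.2.scomp t hφ⟩

lemma HasRightLogDerivAt.unique {g : ℝ → G} {ξ η : E'} {t : ℝ} (h : HasRightLogDerivAt g ξ t)
    (h' : HasRightLogDerivAt g η t) : ξ = η := h.2.unique h'.2

lemma hasRightLogDerivAt_const (k : G) (t : ℝ) :
    HasRightLogDerivAt (fun _ => k) (0 : E') t :=
  ⟨continuousAt_const, hasDerivAt_const _ _⟩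

variable (E' G) in
/-- The differential at the identity of the right translation by a group element near the identity,
in the chart at the identity. -/
def rightTranslation (x : E') : E' →L[ℝ] E' :=
  fderiv ℝ (fun y => chartOne E' G ((chartOne E' G).symm y * (chartOne E' G).symm x))
    (chartOne E' G 1)

lemma rightTranslation_one : rightTranslation E' G (chartOne E' G 1) =
    ContinuousLinearMap.id ℝ E' := by
  have : HasFDerivAt (fun y => chartOne E' G ((chartOne E' G).symm y *
      (chartOne E' G).symm (chartOne E' G 1))) (ContinuousLinearMap.id ℝ E') (chartOne E' G 1) := by
    refine (hasFDerivAt_id (chartOne E' G 1)).congr_of_eventuallyEq ?_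
    filter_upwards [isOpen_chartOne_target.mem_nhds chartOne_one_mem_target] with y hy
    rw [chartOne_symm_chartOne_one, mul_one, (chartOne E' G).right_inv hy, id]
  exact this.fderiv

variable [LieGroup 𝓘(ℝ, E') ∞ G]

lemma contMDiff_mul_right_const (k : G) :
    ContMDiff 𝓘(ℝ, E') 𝓘(ℝ, E') ∞ (fun a : G => a * k) := contMDiff_id.mul contMDiff_const

/-- A partial derivative of the group multiplication read in the chart, which is jointly smooth near
the pair in question. -/
lemma contDiffAt_rightTranslation {x : E'} (hx : x ∈ (chartOne E' G).target) :
    ContDiffAt ℝ ∞ (rightTranslation E' G) x := by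
  refine ContDiffAt.fderiv (n := ∞) (f := fun x y =>
    chartOne E' G ((chartOne E' G).symm y * (chartOne E' G).symm x)) (g := fun _ => chartOne E' G 1)
    ?_ contDiffAt_const (by simp)
  rw [← contMDiffAt_iff_contDiffAt]
  have h1 : ContMDiffAt 𝓘(ℝ, E' × E') 𝓘(ℝ, E') ∞
      (fun p : E' × E' => (chartOne E' G).symm p.2 * (chartOne E' G).symm p.1)
      (x, chartOne E' G 1) :=
    ((contMDiffAt_chartOne_symm chartOne_one_mem_target).comp (x, chartOne E' G 1)
      contDiff_snd.contMDiff.contMDiffAt).mul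
      ((contMDiffAt_chartOne_symm hx).comp (x, chartOne E' G 1)
      contDiff_fst.contMDiff.contMDiffAt)
  refine (contMDiffAt_chartOne ?_).comp (x, chartOne E' G 1) h1
  simpa using (chartOne E' G).map_target hx

/-- Near t write g(s) = (g(s) g(t)⁻¹) g(t): the first factor passes through 1 with chart velocity ξ,
and the chain rule does the rest. -/
lemma HasRightLogDerivAt.hasDerivAt_comp {F : Type*} [NormedAddCommGroup F]
    [NormedSpace ℝ F] {f : G → F} {g : ℝ → G} {t : ℝ} {ξ : E'} (hg : HasRightLogDerivAt g ξ t)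
    (hf : ContMDiffAt 𝓘(ℝ, E') 𝓘(ℝ, F) ∞ f (g t)) :
    HasDerivAt (fun s => f (g s)) (fderiv ℝ (fun y => f ((chartOne E' G).symm y * g t))
      (chartOne E' G 1) ξ) t := by
  have : IsTopologicalGroup G := topologicalGroup_of_lieGroup 𝓘(ℝ, E') ∞
  have h := hasDerivAt_comp_of_chartOne (f := fun y => f (y * g t)) (X := fun s => g s * (g t)⁻¹)
    (hg.1.mul continuousAt_const) (by simp) hg.2
    (ContMDiffAt.comp _ (by simpa using hf) (contMDiff_mul_right_const (g t)).contMDiffAt)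
  simpa using h

lemma HasRightLogDerivAt.hasDerivAt_chartOne {g : ℝ → G} {t : ℝ} {ξ : E'}
    (hg : HasRightLogDerivAt g ξ t) (hs : g t ∈ (chartOne E' G).source) :
    HasDerivAt (fun s => chartOne E' G (g s))
      (rightTranslation E' G (chartOne E' G (g t)) ξ) t := by
  have h := hg.hasDerivAt_comp (contMDiffAt_chartOne hs)
  rwa [rightTranslation, (chartOne E' G).left_inv hs]

/-- Right translation by (g t)⁻¹ undoes right translation by g t, so in the chart its differential
is a left inverse of `rightTranslation` at g t and recovers ξ. This turns solutions of x' = R(x)ξ in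
the chart into curves with right logarithmic derivative ξ. -/
lemma hasRightLogDerivAt_of_chartOne {g : ℝ → G} {t : ℝ} {ξ : E'} (hc : ContinuousAt g t)
    (hs : g t ∈ (chartOne E' G).source)
    (hg : HasDerivAt (fun s => chartOne E' G (g s))
      (rightTranslation E' G (chartOne E' G (g t)) ξ) t) : HasRightLogDerivAt g ξ t := by
  have : IsTopologicalGroup G := topologicalGroup_of_lieGroup 𝓘(ℝ, E') ∞
  refine ⟨hc, ?_⟩
  have h1 : ContMDiffAt 𝓘(ℝ, E') 𝓘(ℝ, E') ∞ (fun y => chartOne E' G (y * (g t)⁻¹)) (g t) :=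
    ContMDiffAt.comp _ (contMDiffAt_chartOne (by simp))
      (contMDiff_mul_right_const (g t)⁻¹).contMDiffAt
  have h := hasDerivAt_comp_of_chartOne hc hs hg h1
  convert h using 1
  have h2 : ContDiffAt ℝ ∞ (fun y => chartOne E' G ((chartOne E' G).symm y * g t))
      (chartOne E' G 1) :=
    contDiffAt_comp_chartOne_symm (f := fun y => chartOne E' G (y * g t)) chartOne_one_mem_target
      (ContMDiffAt.comp _ (contMDiffAt_chartOne (by simpa using hs))
        (contMDiff_mul_right_const (g t)).contMDiffAt)
  have h3 : ContDiffAt ℝ ∞ (fun y => chartOne E' G ((chartOne E' G).symm y * (g t)⁻¹))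
      (chartOne E' G (g t)) :=
    contDiffAt_comp_chartOne_symm (f := fun y => chartOne E' G (y * (g t)⁻¹))
      ((chartOne E' G).map_source hs) (by rwa [(chartOne E' G).left_inv hs])
  have h4 := HasFDerivAt.comp (chartOne E' G 1)
    (g := fun y => chartOne E' G ((chartOne E' G).symm y * (g t)⁻¹))
    (g' := fderiv ℝ (fun y => chartOne E' G ((chartOne E' G).symm y * (g t)⁻¹))
      (chartOne E' G (g t)))
    (f := fun y => chartOne E' G ((chartOne E' G).symm y * g t))
    (by simpa using (h3.differentiableAt (by simp)).hasFDerivAt)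
    (h2.differentiableAt (by simp)).hasFDerivAt
  have h5 : HasFDerivAt ((fun y => chartOne E' G ((chartOne E' G).symm y * (g t)⁻¹)) ∘
      fun y => chartOne E' G ((chartOne E' G).symm y * g t)) (ContinuousLinearMap.id ℝ E')
      (chartOne E' G 1) := by
    refine (hasFDerivAt_id (chartOne E' G 1)).congr_of_eventuallyEq ?_
    have hc : ContinuousAt (fun y => (chartOne E' G).symm y * g t) (chartOne E' G 1) :=
      (contMDiffAt_chartOne_symm chartOne_one_mem_target).continuousAt.mul continuousAt_const
    filter_upwards [isOpen_chartOne_target.mem_nhds chartOne_one_mem_target,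
      hc.preimage_mem_nhds (isOpen_chartOne_source.mem_nhds (by simpa using hs))] with y hy hy'
    simp only [Function.comp_apply]
    rw [(chartOne E' G).left_inv hy', mul_inv_cancel_right, (chartOne E' G).right_inv hy, id]
  have h6 := h4.unique h5
  have h7 := congrArg (fun L => L ξ) h6
  simp only [ContinuousLinearMap.comp_apply, ContinuousLinearMap.id_apply] at h7
  rw [rightTranslation, (chartOne E' G).left_inv hs]
  exact h7.symm

/-- A curve whose right logarithmic derivative vanishes is constant. -/
lemma eq_of_hasRightLogDerivAt_zero {q : ℝ → G} {s : Set ℝ} (ho : IsOpen s)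
    (hs : IsPreconnected s) (h : ∀ t ∈ s, HasRightLogDerivAt q (0 : E') t) {t₀ t₁ : ℝ}
    (h₀ : t₀ ∈ s) (h₁ : t₁ ∈ s) : q t₀ = q t₁ := by
  have : IsTopologicalGroup G := topologicalGroup_of_lieGroup 𝓘(ℝ, E') ∞
  have hloc : IsLocallyConstant (fun t : s => q t) := by
    rw [IsLocallyConstant.iff_eventually_eq]
    rintro ⟨t, ht⟩
    -- Translating by (q t)⁻¹ brings the curve near the identity, where the single chart suffices;
    -- the chart velocity R(x)0 is zero there.
    have hZ : ∀ r ∈ s, HasRightLogDerivAt (fun r => q r * (q t)⁻¹) (0 : E') r :=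
      fun r hr => (h r hr).mul_const _
    have hev : ∀ᶠ r in 𝓝 t, r ∈ s ∧ q r * (q t)⁻¹ ∈ (chartOne E' G).source :=
      Filter.Eventually.and (ho.mem_nhds ht) ((hZ t ht).1.preimage_mem_nhds
        (isOpen_chartOne_source.mem_nhds (by simp)))
    obtain ⟨ε, hε, hball⟩ := Metric.eventually_nhds_iff_ball.1 hev
    have hd : ∀ r ∈ Metric.ball t ε, HasDerivAt (fun r => chartOne E' G (q r * (q t)⁻¹)) 0 r := by
      intro r hr
      simpa using (hZ r (hball r hr).1).hasDerivAt_chartOne (hball r hr).2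
    have hconst : ∀ r ∈ Metric.ball t ε, q r = q t := by
      intro r hr
      have := Metric.isOpen_ball.is_const_of_deriv_eq_zero (convex_ball t ε).isPreconnected
        (fun r hr => (hd r hr).differentiableAt.differentiableWithinAt)
        (fun r hr => (hd r hr).deriv) hr (Metric.mem_ball_self hε)
      have := (chartOne E' G).injOn (hball r hr).2 (hball t (Metric.mem_ball_self hε)).2 this
      rwa [mul_inv_cancel, mul_inv_eq_one] at this
    have : ∀ᶠ r in 𝓝 t, q r = q t := Metric.eventually_nhds_iff_ball.2 ⟨ε, hε, hconst⟩
    exact (continuous_subtype_val.continuousAt (x := (⟨t, ht⟩ : s))).eventually this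
  have : PreconnectedSpace s := isPreconnected_iff_preconnectedSpace.1 hs
  exact hloc.apply_eq_of_preconnectedSpace ⟨t₀, h₀⟩ ⟨t₁, h₁⟩

/-- With X = g(s)g(t)⁻¹ and Y = k(s)k(t)⁻¹, the curve to differentiate is g(t)⁻¹(X⁻¹Y)g(t). As a
function of (X, Y) it is constant on the diagonal, so its differential kills (ξ, ξ), the common
velocity of X and Y. -/
lemma HasRightLogDerivAt.inv_mul {g k : ℝ → G} {ξ : E'} {t : ℝ} (hg : HasRightLogDerivAt g ξ t)
    (hk : HasRightLogDerivAt k ξ t) : HasRightLogDerivAt (fun s => (g s)⁻¹ * k s) (0 : E') t := by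
  have : IsTopologicalGroup G := topologicalGroup_of_lieGroup 𝓘(ℝ, E') ∞
  refine ⟨hg.1.inv.mul hk.1, ?_⟩
  let f : G → G → E' := fun x y => chartOne E' G ((g t)⁻¹ * (x⁻¹ * y) * g t)
  let f' : E' × E' → E' := fun p => f ((chartOne E' G).symm p.1) ((chartOne E' G).symm p.2)
  have hsymm := contMDiffAt_chartOne_symm (chartOne_one_mem_target (E' := E') (G := G))
  have hf' : ContDiffAt ℝ ∞ f' (chartOne E' G 1, chartOne E' G 1) := by
    rw [← contMDiffAt_iff_contDiffAt]
    have h1 : ContMDiffAt 𝓘(ℝ, E' × E') 𝓘(ℝ, E') ∞ (fun p : E' × E' =>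
        (g t)⁻¹ * (((chartOne E' G).symm p.1)⁻¹ * (chartOne E' G).symm p.2) * g t)
        (chartOne E' G 1, chartOne E' G 1) := by
      refine (contMDiffAt_const.mul (ContMDiffAt.mul (ContMDiffAt.inv ?_) ?_)).mul contMDiffAt_const
      · exact hsymm.comp (chartOne E' G 1, chartOne E' G 1) contDiff_fst.contMDiff.contMDiffAt
      · exact hsymm.comp (chartOne E' G 1, chartOne E' G 1) contDiff_snd.contMDiff.contMDiffAt
    refine (contMDiffAt_chartOne ?_).comp (chartOne E' G 1, chartOne E' G 1) h1
    simp
  have hd := (hf'.differentiableAt (by simp)).hasFDerivAt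
  have hdiag : HasFDerivAt (fun y => f' (y, y)) _ (chartOne E' G 1) :=
    HasFDerivAt.comp (g := f') (f := fun y => (y, y)) (chartOne E' G 1) hd
      ((hasFDerivAt_id (chartOne E' G 1)).prodMk (hasFDerivAt_id (chartOne E' G 1)))
  have hconst : (fun y => f' (y, y)) = fun _ => chartOne E' G 1 := by
    funext y
    simp [f', f]
  rw [hconst] at hdiag
  have hzero := congrArg (fun L => L ξ) (hdiag.unique (hasFDerivAt_const _ _))
  simp only [ContinuousLinearMap.comp_apply, ContinuousLinearMap.prod_apply,
    ContinuousLinearMap.id_apply, zero_apply] at hzero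
  have hXY := hg.2.prodMk hk.2
  have hd' : HasFDerivAt f' (fderiv ℝ f' (chartOne E' G 1, chartOne E' G 1))
      ((fun s => (chartOne E' G (g s * (g t)⁻¹), chartOne E' G (k s * (k t)⁻¹))) t) := by
    simpa using hd
  have hfin := hd'.comp_hasDerivAt t hXY
  rw [hzero] at hfin
  refine hfin.congr_of_eventuallyEq ?_
  have hcg : ContinuousAt (fun s => g s * (g t)⁻¹) t := hg.1.mul continuousAt_const
  have hck : ContinuousAt (fun s => k s * (k t)⁻¹) t := hk.1.mul continuousAt_const
  filter_upwards [hcg.preimage_mem_nhds ((isOpen_chartOne_source (E' := E')).mem_nhds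
      (by simp)),
    hck.preimage_mem_nhds ((isOpen_chartOne_source (E' := E')).mem_nhds
      (by simp))] with s h1 h2
  simp only [Function.comp_apply, f', f]
  rw [(chartOne E' G).left_inv h1, (chartOne E' G).left_inv h2]
  congr 1
  group

/-- Uniqueness for `g' = a g`. -/
lemma eqOn_of_hasRightLogDerivAt {g k : ℝ → G} {a : ℝ → E'} {s : Set ℝ} (ho : IsOpen s)
    (hs : IsPreconnected s) (hg : ∀ t ∈ s, HasRightLogDerivAt g (a t) t)
    (hk : ∀ t ∈ s, HasRightLogDerivAt k (a t) t) {t₀ : ℝ} (h₀ : t₀ ∈ s) (he : g t₀ = k t₀) :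
    EqOn g k s := by
  intro t ht
  have := eq_of_hasRightLogDerivAt_zero ho hs (fun r hr => (hg r hr).inv_mul (hk r hr)) h₀ ht
  simp only [he, inv_mul_cancel] at this
  exact inv_mul_eq_one.1 this.symm

end RightLogDeriv
end

noncomputable section

/-! ### Existence and smooth parameter dependence for g' = a g. -/

section Evolution

open Set Filter Topology

universe v

variable {E' : Type v} [NormedAddCommGroup E'] [NormedSpace ℝ E'] [FiniteDimensional ℝ E']
  {G : Type*} [TopologicalSpace G] [ChartedSpace E' G] [Group G] [LieGroup 𝓘(ℝ, E') ∞ G]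

/-! ### Evolution of small controls -/

variable (E' G) in
/-- For a small control `α` on a fixed time interval, the equation `g' = α g`, `g 0 = 1` is solvable
and the value at time `1` depends smoothly on `α`. -/
lemma exists_evolution_of_small :
    ∃ e : C(TimeInterval, E') → ℝ → G,
      (∀ᶠ α in 𝓝 0, e α 0 = 1 ∧ ∀ τ (hτ : τ ∈ Ioo (-2 : ℝ) 2),
        HasRightLogDerivAt (e α) (α ⟨τ, Ioo_subset_Icc_self hτ⟩) τ) ∧
      ∀ n : ℕ, ∀ᶠ α in 𝓝 0,
        ContMDiffAt 𝓘(ℝ, C(TimeInterval, E')) 𝓘(ℝ, E') n (fun α => e α 1) α := by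
  have h22 : (-2 : ℝ) ≤ 2 := by norm_num
  have hcomp : CompleteSpace E' := FiniteDimensional.complete ℝ E'
  -- Composing with ρ makes the vector field of the equation smooth on all of E'. For small α the
  -- solution stays where ρ is the identity, so there it solves the original equation.
  obtain ⟨ρ, hρ, hρid, hρU⟩ := exists_contDiff_eventuallyEq_id
    (isOpen_chartOne_target.mem_nhds (chartOne_one_mem_target (E' := E') (G := G)))
  have hR : ContDiff ℝ ∞ (fun x => rightTranslation E' G (ρ x)) :=
    contDiff_iff_contDiffAt.2 fun x => (contDiffAt_rightTranslation (hρU x)).comp x hρ.contDiffAt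
  obtain ⟨S, hS, hS0, hSe⟩ := exists_contDiffAt_solution hR (chartOne E' G 1)
  obtain ⟨r, hr, hball⟩ := Metric.eventually_nhds_iff_ball.1 (hρid.and
    (isOpen_chartOne_target.mem_nhds (chartOne_one_mem_target (E' := E') (G := G))))
  have hclose : ∀ᶠ α in 𝓝 (0 : C(TimeInterval, E')), ∀ t,
      S α t ∈ Metric.ball (chartOne E' G 1) r := by
    have := hS.continuousAt.preimage_mem_nhds (Metric.ball_mem_nhds _ hr)
    filter_upwards [this] with α hα t
    rw [hS0] at hα
    exact (ContinuousMap.dist_apply_le_dist t).trans_lt hα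
  refine ⟨fun α t => (chartOne E' G).symm (IccExtend h22 (S α) t), ?_, fun n => ?_⟩
  · filter_upwards [hSe, hclose] with α hα hα'
    have hmem : ∀ t, IccExtend h22 (S α) t ∈ Metric.ball (chartOne E' G 1) r := fun t => hα' _
    refine ⟨?_, fun τ hτ => ?_⟩
    · have h0 : (0 : ℝ) ∈ Icc (-2 : ℝ) 2 := by constructor <;> norm_num
      rw [IccExtend_of_mem _ _ h0, hα]
      simp [primitive_apply]
    · have hd := hasDerivAt_of_eq_primitive hα hτ
      have hsymm := contMDiffAt_chartOne_symm (hball _ (hmem τ)).2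
      have hsource : (chartOne E' G).symm (IccExtend h22 (S α) τ) ∈ (chartOne E' G).source :=
        (chartOne E' G).map_target (hball _ (hmem τ)).2
      refine hasRightLogDerivAt_of_chartOne
        (ContinuousAt.comp (f := IccExtend h22 (S α)) hsymm.continuousAt hd.continuousAt) hsource ?_
      have he : ∀ t, chartOne E' G ((chartOne E' G).symm (IccExtend h22 (S α) t)) =
          IccExtend h22 (S α) t := fun t => (chartOne E' G).right_inv (hball _ (hmem t)).2
      simp only [he]
      convert hd using 1
      have := (hball _ (hα' ⟨τ, Ioo_subset_Icc_self hτ⟩)).1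
      rw [IccExtend_of_mem _ _ (Ioo_subset_Icc_self hτ)]
      simp only [pointwiseApply_apply, ContinuousMap.comp_apply, ContinuousMap.coe_mk]
      rw [this, id]
  · have h1 : (1 : ℝ) ∈ Icc (-2 : ℝ) 2 := by constructor <;> norm_num
    -- Smoothness of order ∞ at the point 0 gives, for each finite n, order n on a neighbourhood
    -- that may depend on n. Hence the quantifier over n stays outside.
    filter_upwards [hclose, (hS.of_le (show ((n : ℕ) : WithTop ℕ∞) ≤ ∞ by
      exact_mod_cast le_top)).eventually (by simp)] with α hα hα'
    have hev : ContDiffAt ℝ n (fun α => S α ⟨1, h1⟩) α :=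
      ContDiffAt.comp α (g := ContinuousMap.evalCLM ℝ (⟨1, h1⟩ : TimeInterval))
        (ContinuousLinearMap.contDiff _).contDiffAt hα'
    have := ((contMDiffAt_chartOne_symm (hball _ (hα ⟨1, h1⟩)).2).of_le
      (show ((n : ℕ) : WithTop ℕ∞) ≤ ∞ by exact_mod_cast le_top)).comp α hev.contMDiffAt
    refine this.congr_of_eventuallyEq (Eventually.of_forall fun β => ?_)
    simp only [Function.comp_apply]
    rw [IccExtend_of_mem _ _ h1]

/-! ### Global existence -/

/-- The control τ ↦ δ a(t₀ + δτ) tends to 0 with δ, so for some δ > 0 the small-control solution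
exists; undoing the time change gives a solution around t₀. -/
lemma exists_local_evolution {a : ℝ → E'} (ha : ContDiff ℝ ∞ a) (t₀ : ℝ) :
    ∃ δ > 0, ∃ g : ℝ → G, ∀ t ∈ Ioo (t₀ - δ) (t₀ + δ), HasRightLogDerivAt g (a t) t := by
  obtain ⟨e, he, -⟩ := exists_evolution_of_small E' G
  have hb : ContDiff ℝ ∞ (fun p : ℝ × ℝ => p.1 • a (t₀ + p.1 * p.2)) :=
    contDiff_fst.smul (ha.comp (contDiff_const.add (contDiff_fst.mul contDiff_snd)))
  have hα := (contDiff_restrictTime hb).continuous.continuousAt (x := 0)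
  have h0 : (restrictTime (fun t => (fun p : ℝ × ℝ => p.1 • a (t₀ + p.1 * p.2)) (0, t))
      (hb.continuous.comp (Continuous.prodMk_right (0 : ℝ)))) = 0 := by
    ext t
    simp
  rw [ContinuousAt, h0] at hα
  obtain ⟨δ, hδ, hδ'⟩ := ((hα.eventually he).filter_mono nhdsWithin_le_nhds |>.and
    (self_mem_nhdsWithin (s := Ioi (0 : ℝ)))).exists
  refine ⟨δ, hδ', fun t => e (restrictTime (fun t => δ • a (t₀ + δ * t))
    (hb.continuous.comp (Continuous.prodMk_right δ))) ((t - t₀) / δ), fun t ht => ?_⟩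
  have hτ : (t - t₀) / δ ∈ Ioo (-2 : ℝ) 2 := by
    rw [mem_Ioo, lt_div_iff₀ hδ', div_lt_iff₀ hδ']
    constructor <;> linarith [ht.1, ht.2]
  have h1 := hδ.2 _ hτ
  have h2 : HasDerivAt (fun t => (t - t₀) / δ) (1 / δ) t :=
    ((hasDerivAt_id t).sub_const t₀).div_const δ
  have h3 := HasRightLogDerivAt.scomp (φ := fun t => (t - t₀) / δ) h1 h2
  simp only [restrictTime_apply, smul_smul] at h3
  rwa [one_div, inv_mul_cancel₀ hδ'.ne', one_smul, mul_div_cancel₀ _ hδ'.ne',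
    add_sub_cancel] at h3

-- A constant right factor makes k agree with g at t₀ without changing its logarithmic derivative;
-- uniqueness on the interval s ∩ u then makes the pieces fit.
omit [FiniteDimensional ℝ E'] in
lemma exists_evolution_union {a : ℝ → E'} {g k : ℝ → G} {s u : Set ℝ} (hso : IsOpen s)
    (huo : IsOpen u) (hs : s.OrdConnected) (hu : u.OrdConnected)
    (hg : ∀ t ∈ s, HasRightLogDerivAt g (a t) t) (hk : ∀ t ∈ u, HasRightLogDerivAt k (a t) t)
    {t₀ : ℝ} (h₀ : t₀ ∈ s) (h₀' : t₀ ∈ u) :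
    ∃ f : ℝ → G, EqOn f g s ∧ ∀ t ∈ s ∪ u, HasRightLogDerivAt f (a t) t := by
  classical
  have : IsTopologicalGroup G := topologicalGroup_of_lieGroup 𝓘(ℝ, E') ∞
  let k' : ℝ → G := fun t => k t * ((k t₀)⁻¹ * g t₀)
  have hk' : ∀ t ∈ u, HasRightLogDerivAt k' (a t) t := fun t ht => (hk t ht).mul_const _
  have heq : EqOn g k' (s ∩ u) :=
    eqOn_of_hasRightLogDerivAt (hso.inter huo) (hs.inter hu).isPreconnected
      (fun t ht => hg t ht.1) (fun t ht => hk' t ht.2) ⟨h₀, h₀'⟩ (by simp [k'])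
  have hfs : EqOn (s.piecewise g k') g s := piecewise_eqOn _ _ _
  have hfu : EqOn (s.piecewise g k') k' u := by
    intro t ht
    by_cases hts : t ∈ s
    · rw [hfs hts, heq ⟨hts, ht⟩]
    · exact piecewise_eq_of_notMem _ _ _ hts
  refine ⟨s.piecewise g k', hfs, ?_⟩
  rintro t (ht | ht)
  · exact (hg t ht).congr (hfs.eventuallyEq_of_mem (hso.mem_nhds ht))
  · exact (hk' t ht).congr (hfu.eventuallyEq_of_mem (huo.mem_nhds ht))

/-- The times reachable from 0 form an open and closed set. Closedness needs no a priori bound: the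
local solution around a limit time carries no initial condition and can be glued to any solution
that enters its interval. -/
lemma exists_evolution {a : ℝ → E'} (ha : ContDiff ℝ ∞ a) :
    ∃ g : ℝ → G, g 0 = 1 ∧ ∀ t, HasRightLogDerivAt g (a t) t := by
  have : IsTopologicalGroup G := topologicalGroup_of_lieGroup 𝓘(ℝ, E') ∞
  let T : Set ℝ := {t | ∃ s : Set ℝ, IsOpen s ∧ s.OrdConnected ∧ 0 ∈ s ∧ t ∈ s ∧
    ∃ g : ℝ → G, g 0 = 1 ∧ ∀ r ∈ s, HasRightLogDerivAt g (a r) r}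
  have h0 : (0 : ℝ) ∈ T := by
    obtain ⟨δ, hδ, g, hg⟩ := exists_local_evolution (G := G) ha 0
    exact ⟨_, isOpen_Ioo, ordConnected_Ioo, by simpa, by simpa, fun t => g t * (g 0)⁻¹, by simp,
      fun r hr => (hg r hr).mul_const _⟩
  have hT : T = univ := by
    refine IsClopen.eq_univ ⟨isClosed_of_closure_subset fun t ht => ?_, ?_⟩ ⟨0, h0⟩
    · obtain ⟨δ, hδ, k, hk⟩ := exists_local_evolution (G := G) ha t
      obtain ⟨t', ht', s, hso, hs, h0s, hts, g, hg0, hg⟩ := mem_closure_iff.1 ht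
        (Ioo (t - δ) (t + δ)) isOpen_Ioo ⟨by linarith, by linarith⟩
      obtain ⟨f, hfg, hf⟩ := exists_evolution_union hso isOpen_Ioo hs ordConnected_Ioo hg hk
        hts ht'
      exact ⟨_, hso.union isOpen_Ioo, ((isPreconnected_iff_ordConnected.2 hs).union t' hts ht'
        (isPreconnected_iff_ordConnected.2 ordConnected_Ioo)).ordConnected, Or.inl h0s,
        Or.inr ⟨by linarith, by linarith⟩, f, (hfg h0s).trans hg0, hf⟩
    · rw [isOpen_iff_mem_nhds]
      rintro t ⟨s, hso, hs, h0s, hts, g, hg⟩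
      filter_upwards [hso.mem_nhds hts] with r hr
      exact ⟨s, hso, hs, h0s, hr, g, hg⟩
  -- Every time has its own solution; by uniqueness any two agree where both live, so the diagonal r
  -- ↦ g r r is one global solution.
  choose s hso hs h0s hts g hg0 hg using fun t => hT.ge (mem_univ t)
  have key : ∀ t, EqOn (fun r => g r r) (g t) (s t) := fun t r hr =>
    eqOn_of_hasRightLogDerivAt ((hso r).inter (hso t)) ((hs r).inter (hs t)).isPreconnected
      (fun q hq => hg r q hq.1) (fun q hq => hg t q hq.2) ⟨h0s r, h0s t⟩
      ((hg0 r).trans (hg0 t).symm) ⟨hts r, hr⟩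
  exact ⟨fun r => g r r, hg0 0, fun t => (hg t t (hts t)).congr
    ((key t).eventuallyEq_of_mem ((hso t).mem_nhds (hts t)))⟩

/-! ### Smooth dependence on parameters -/

/-- For t and r near t₀ the factor g(w,r) g(w,t)⁻¹ is the evolution of a small control depending
smoothly on (w,t,r). Smoothness at one time thus passes to all nearby times, with a step independent
of that time, and connectedness of the line carries it from t = 0 everywhere. The order n is fixed
because the admissible size of the control depends on it. -/
lemma contMDiffAt_evolution_nat {W : Type} [NormedAddCommGroup W] [NormedSpace ℝ W]
    {a : W × ℝ → E'} (ha : ContDiff ℝ ∞ a) {g : W × ℝ → G} (hg0 : ∀ w, g (w, 0) = 1)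
    (hg : ∀ w t, HasRightLogDerivAt (fun s => g (w, s)) (a (w, t)) t) (n : ℕ) (w₀ : W) (t : ℝ) :
    ContMDiffAt 𝓘(ℝ, W × ℝ) 𝓘(ℝ, E') n g (w₀, t) := by
  have : IsTopologicalGroup G := topologicalGroup_of_lieGroup 𝓘(ℝ, E') ∞
  have : ContMDiffMul 𝓘(ℝ, E') n G :=
    ContMDiffMul.of_le (show ((n : ℕ) : WithTop ℕ∞) ≤ ∞ by exact_mod_cast le_top)
  obtain ⟨e, he, hen⟩ := exists_evolution_of_small E' G
  have hlocal : ∀ t₀ : ℝ, ∃ δ > 0, ∀ t ∈ Ioo (t₀ - δ) (t₀ + δ), ∀ s ∈ Ioo (t₀ - δ) (t₀ + δ),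
      ContMDiffAt 𝓘(ℝ, W) 𝓘(ℝ, E') n (fun w => g (w, t)) w₀ →
        ContMDiffAt 𝓘(ℝ, W × ℝ) 𝓘(ℝ, E') n g (w₀, s) := by
    intro t₀
    have hb : ContDiff ℝ ∞ (fun p : (W × ℝ × ℝ) × ℝ =>
        (p.1.2.2 - p.1.2.1) • a (p.1.1, p.1.2.1 + (p.1.2.2 - p.1.2.1) * p.2)) := by
      fun_prop
    -- The equation between times t = q.2.1 and r = q.2.2, with time rescaled so that τ = 0 is t and
    -- τ = 1 is r. The control vanishes for t = r, hence is small near (w₀, t₀, t₀).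
    set α : W × ℝ × ℝ → C(TimeInterval, E') := fun q => restrictTime (fun τ =>
      (q.2.2 - q.2.1) • a (q.1, q.2.1 + (q.2.2 - q.2.1) * τ))
      (hb.continuous.comp (Continuous.prodMk_right q)) with hαdef
    have hα : ContDiff ℝ ∞ α := contDiff_restrictTime hb
    have hαt := hα.continuous.continuousAt (x := (w₀, t₀, t₀))
    have h0 : α (w₀, t₀, t₀) = 0 := by
      ext τ
      simp [α]
    rw [ContinuousAt, h0] at hαt
    have hev := hαt.eventually (he.and (hen n))
    rw [nhds_prod_eq, nhds_prod_eq] at hev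
    obtain ⟨P, hP, Q, hQ, hPQ⟩ := eventually_prod_iff.1 hev
    obtain ⟨Q₁, hQ₁, Q₂, hQ₂, hQQ⟩ := eventually_prod_iff.1 hQ
    obtain ⟨δ, hδ, hball⟩ := Metric.eventually_nhds_iff_ball.1 (hQ₁.and hQ₂)
    rw [Real.ball_eq_Ioo] at hball
    refine ⟨δ, hδ, fun t ht s hs hsm => ?_⟩
    have hrep : ∀ w, P w → ∀ r ∈ Ioo (t₀ - δ) (t₀ + δ),
        g (w, r) = e (α (w, t, r)) 1 * g (w, t) := by
      intro w hw r hr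
      obtain ⟨⟨h1, h2⟩, -⟩ := hPQ hw (hQQ (hball t ht).1 (hball r hr).2)
      have h3 : ∀ τ ∈ Ioo (-2 : ℝ) 2, HasRightLogDerivAt
          (fun τ => g (w, t + (r - t) * τ) * (g (w, t))⁻¹)
          ((r - t) • a (w, t + (r - t) * τ)) τ := by
        intro τ _
        refine HasRightLogDerivAt.mul_const ?_ _
        exact HasRightLogDerivAt.scomp (g := fun s => g (w, s)) (φ := fun τ => t + (r - t) * τ)
          (hg w _) (by simpa using ((hasDerivAt_id τ).const_mul (r - t)).const_add t)
      have h4 := eqOn_of_hasRightLogDerivAt isOpen_Ioo isPreconnected_Ioo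
        h3 (fun τ hτ => h2 τ hτ) (t₀ := 0) (by constructor <;> norm_num) (by simp [h1])
      have h5 := h4 (show (1 : ℝ) ∈ Ioo (-2 : ℝ) 2 by constructor <;> norm_num)
      simp only [mul_one, add_sub_cancel] at h5
      rw [← h5, inv_mul_cancel_right]
    have h6 := (hPQ hP.self_of_nhds (hQQ (hball t ht).1 (hball s hs).2)).2
    have h7 : ContMDiffAt 𝓘(ℝ, W × ℝ) 𝓘(ℝ, E') n (fun p : W × ℝ => e (α (p.1, t, p.2)) 1)
        (w₀, s) := by
      have h8 : ContDiff ℝ n (fun p : W × ℝ => α (p.1, t, p.2)) :=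
        (hα.comp (contDiff_fst.prodMk (contDiff_const.prodMk contDiff_snd))).of_le
          (by exact_mod_cast le_top)
      exact ContMDiffAt.comp (w₀, s) (g := fun α => e α 1) (f := fun p : W × ℝ => α (p.1, t, p.2))
        h6 h8.contMDiff.contMDiffAt
    have h9 : ContMDiffAt 𝓘(ℝ, W × ℝ) 𝓘(ℝ, E') n (fun p : W × ℝ => g (p.1, t)) (w₀, s) :=
      ContMDiffAt.comp (w₀, s) (g := fun w => g (w, t)) hsm contDiff_fst.contMDiff.contMDiffAt
    refine (h7.mul h9).congr_of_eventuallyEq ?_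
    rw [nhds_prod_eq]
    filter_upwards [prod_mem_prod hP (Ioo_mem_nhds hs.1 hs.2)] with p hp
    exact hrep p.1 hp.1 p.2 hp.2
  have hslice : ∀ t, ContMDiffAt 𝓘(ℝ, W × ℝ) 𝓘(ℝ, E') n g (w₀, t) →
      ContMDiffAt 𝓘(ℝ, W) 𝓘(ℝ, E') n (fun w => g (w, t)) w₀ := fun t ht =>
    ContMDiffAt.comp w₀ (f := fun w => (w, t)) ht
      (contDiff_id.prodMk contDiff_const).contMDiff.contMDiffAt
  let T : Set ℝ := {t | ContMDiffAt 𝓘(ℝ, W × ℝ) 𝓘(ℝ, E') n g (w₀, t)}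
  have hT : T = univ := by
    refine IsClopen.eq_univ ⟨isClosed_of_closure_subset fun t ht => ?_, ?_⟩ ⟨0, ?_⟩
    · obtain ⟨δ, hδ, h⟩ := hlocal t
      obtain ⟨t', ht', h'⟩ := mem_closure_iff.1 ht
        (Ioo (t - δ) (t + δ)) isOpen_Ioo ⟨by linarith, by linarith⟩
      exact h t' ht' t ⟨by linarith, by linarith⟩ (hslice t' h')
    · rw [isOpen_iff_mem_nhds]
      intro t ht
      obtain ⟨δ, hδ, h⟩ := hlocal t
      filter_upwards [Ioo_mem_nhds (show t - δ < t by linarith) (show t < t + δ by linarith)]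
        with r hr
      exact h t ⟨by linarith, by linarith⟩ r hr (hslice t ht)
    · obtain ⟨δ, hδ, h⟩ := hlocal 0
      refine h 0 (by simpa) 0 (by simpa) ?_
      simp only [hg0]
      exact contMDiffAt_const
  exact hT.ge (mem_univ t)

/-- The solution of `g' = a g`, `g 0 = 1` depends smoothly on parameters. -/
lemma contMDiff_evolution {W : Type} [NormedAddCommGroup W] [NormedSpace ℝ W]
    {a : W × ℝ → E'} (ha : ContDiff ℝ ∞ a) {g : W × ℝ → G} (hg0 : ∀ w, g (w, 0) = 1)
    (hg : ∀ w t, HasRightLogDerivAt (fun s => g (w, s)) (a (w, t)) t) :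
    ContMDiff 𝓘(ℝ, W × ℝ) 𝓘(ℝ, E') ∞ g :=
  contMDiff_infty.2 fun n p => contMDiffAt_evolution_nat ha hg0 hg n p.1 p.2

end Evolution
end

noncomputable section

/-! ### Parallel transport along curves, and its intrinsic description in tangent bundles. -/

section Transport

open Set Filter Topology

universe v

/-! ### Right logarithmic derivatives and the tangent bundle -/

section TangentMap

variable {E' : Type*} [NormedAddCommGroup E'] [NormedSpace ℝ E']
  {G : Type*} [TopologicalSpace G] [ChartedSpace E' G]

lemma hasMFDerivAt_of_chartOne [One G] {X : ℝ → G} {ξ : E'} {t : ℝ} (h1 : X t = 1)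
    (hc : ContinuousAt X t) (hd : HasDerivAt (fun s => chartOne E' G (X s)) ξ t) :
    HasMFDerivAt 𝓘(ℝ, ℝ) 𝓘(ℝ, E') X t (ContinuousLinearMap.toSpanSingleton ℝ ξ : ℝ →L[ℝ] E') := by
  refine ⟨hc, ?_⟩
  simp only [writtenInExtChartAt, h1, mfld_simps]
  exact hd.hasFDerivAt.hasFDerivWithinAt

lemma hasDerivAt_chartOne_iff_tangentMap [One G] {X : ℝ → G} {ξ : E'} {t : ℝ} (h1 : X t = 1) :
    (ContinuousAt X t ∧ HasDerivAt (fun s => chartOne E' G (X s)) ξ t) ↔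
      MDifferentiableAt 𝓘(ℝ, ℝ) 𝓘(ℝ, E') X t ∧
        tangentMap 𝓘(ℝ, ℝ) 𝓘(ℝ, E') X ⟨t, (1 : ℝ)⟩ = ⟨1, ξ⟩ := by
  constructor
  · rintro ⟨hc, hd⟩
    have h := hasMFDerivAt_of_chartOne h1 hc hd
    refine ⟨h.mdifferentiableAt, ?_⟩
    refine Bundle.TotalSpace.ext h1 (heq_of_eq ?_)
    exact (congrArg (fun L : ℝ →L[ℝ] E' => L 1) h.mfderiv).trans (one_smul ℝ ξ)
  · rintro ⟨hm, ht⟩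
    refine ⟨hm.continuousAt, ?_⟩
    have h := hm.hasMFDerivAt.2
    simp only [writtenInExtChartAt, h1, mfld_simps] at h
    have h2 : HasFDerivAt (fun s => chartOne E' G (X s))
      (mfderiv 𝓘(ℝ, ℝ) 𝓘(ℝ, E') X t : ℝ →L[ℝ] E') t := hasFDerivWithinAt_univ.1 h
    have h3 : (mfderiv 𝓘(ℝ, ℝ) 𝓘(ℝ, E') X t : ℝ →L[ℝ] E') 1 = ξ :=
      eq_of_heq (Bundle.TotalSpace.mk.inj ht).2
    have key : ∀ L : ℝ →L[ℝ] E', HasFDerivAt (fun s => chartOne E' G (X s)) L t → L 1 = ξ →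
      HasDerivAt (fun s => chartOne E' G (X s)) ξ t := fun L hL e => e ▸ hL.hasDerivAt
    exact key _ h2 h3

variable [Group G] [LieGroup 𝓘(ℝ, E') ∞ G]

/-- The right translations by g t and by its inverse are mutually inverse smooth maps, so their
tangent maps carry the equation at g t to the one at 1 and back. This identifies the chart-based
notion with the equation in `IsParallelTransport`. -/
lemma hasRightLogDerivAt_iff_tangentMap {g : ℝ → G} {ξ : E'} {t : ℝ} :
    HasRightLogDerivAt g ξ t ↔ MDifferentiableAt 𝓘(ℝ, ℝ) 𝓘(ℝ, E') g t ∧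
      tangentMap 𝓘(ℝ, ℝ) 𝓘(ℝ, E') g ⟨t, (1 : ℝ)⟩ =
        tangentMap 𝓘(ℝ, E') 𝓘(ℝ, E') (fun a : G => a * g t) ⟨1, ξ⟩ := by
  have : IsTopologicalGroup G := topologicalGroup_of_lieGroup 𝓘(ℝ, E') ∞
  have hmul : ∀ k : G, MDifferentiable 𝓘(ℝ, E') 𝓘(ℝ, E') (fun a : G => a * k) := fun k =>
    (contMDiff_mul_right_const k).mdifferentiable (by simp)
  have hcont : ContinuousAt g t ↔ ContinuousAt (fun s => g s * (g t)⁻¹) t := by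
    refine ⟨fun h => h.mul continuousAt_const, fun h => ?_⟩
    exact (h.mul (continuousAt_const (y := g t))).congr (Eventually.of_forall fun s => by simp)
  rw [HasRightLogDerivAt, hcont, hasDerivAt_chartOne_iff_tangentMap (by simp)]
  have e1 : (fun s => g s * (g t)⁻¹) = (fun a => a * (g t)⁻¹) ∘ g := rfl
  have e2 : g = (fun a => a * g t) ∘ (fun s => g s * (g t)⁻¹) := by
    funext s; simp
  have hd : MDifferentiableAt 𝓘(ℝ, ℝ) 𝓘(ℝ, E') (fun s => g s * (g t)⁻¹) t ↔
      MDifferentiableAt 𝓘(ℝ, ℝ) 𝓘(ℝ, E') g t := by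
    refine ⟨fun h => ?_, fun h => (hmul (g t)⁻¹ (g t)).comp t h⟩
    rw [e2]
    exact (hmul (g t) _).comp t h
  rw [hd]
  refine and_congr_right fun hg => ⟨fun h => ?_, fun h => ?_⟩
  · conv_lhs => rw [e2]
    rw [tangentMap_comp_at ⟨t, (1 : ℝ)⟩ (hmul (g t) _) (hd.2 hg), h]
  · rw [e1, tangentMap_comp_at ⟨t, (1 : ℝ)⟩ (hmul (g t)⁻¹ _) hg, h,
      ← tangentMap_comp_at (⟨1, ξ⟩ : TangentBundle 𝓘(ℝ, E') G) (hmul (g t)⁻¹ _) (hmul (g t) _)]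
    have : ((fun a => a * (g t)⁻¹) ∘ fun a => a * g t) = (id : G → G) := by
      funext s; simp
    rw [this, tangentMap_id]
    rfl

lemma HasRightLogDerivAt.tangentMap_eq {g : ℝ → G} {ξ : E'} {t : ℝ}
    (h : HasRightLogDerivAt g ξ t) (h1 : g t = 1) :
    tangentMap 𝓘(ℝ, ℝ) 𝓘(ℝ, E') g ⟨t, (1 : ℝ)⟩ = ⟨1, ξ⟩ := by
  rw [(hasRightLogDerivAt_iff_tangentMap.1 h).2, h1]
  simp only [mul_one]
  exact congrFun tangentMap_id _

end TangentMap

/-! ### Connections along smooth maps -/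

variable {E : Type*} [NormedAddCommGroup E] [NormedSpace ℝ E]
  {M : Type*} [TopologicalSpace M] [ChartedSpace E M] [IsManifold 𝓘(ℝ, E) ∞ M]
  {E' : Type v} [NormedAddCommGroup E'] [NormedSpace ℝ E']
  {G : Type*} [TopologicalSpace G] [ChartedSpace E' G] [Group G]

namespace TrivialBundleConnection

variable (A : TrivialBundleConnection 𝓘(ℝ, E) M 𝓘(ℝ, E') G)

/-- The pull-back of a connection along a map from a vector space. -/
def pullback {V : Type*} [NormedAddCommGroup V] [NormedSpace ℝ V] (c : V → M) (p : V) :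
    V →L[ℝ] E' :=
  ContinuousLinearMap.comp (M₃ := E') (A.form (c p)) (mfderiv 𝓘(ℝ, V) 𝓘(ℝ, E) c p)

lemma pullback_apply {V : Type*} [NormedAddCommGroup V] [NormedSpace ℝ V] (c : V → M) (p v : V) :
    A.pullback c p v = A.form (c p) (mfderiv 𝓘(ℝ, V) 𝓘(ℝ, E) c p v) := rfl

/-- A composite of smooth maps: the constant section v of the tangent bundle of V, the tangent map
of c, and A as a function on the tangent bundle of M. -/
lemma contDiff_pullback_apply {V : Type*} [NormedAddCommGroup V] [NormedSpace ℝ V] {c : V → M}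
    (hc : ContMDiff 𝓘(ℝ, V) 𝓘(ℝ, E) ∞ c) (v : V) : ContDiff ℝ ∞ (fun p => A.pullback c p v) := by
  have h1 : ContMDiff 𝓘(ℝ, V).tangent 𝓘(ℝ, E).tangent ∞ (tangentMap 𝓘(ℝ, V) 𝓘(ℝ, E) c) :=
    hc.contMDiff_tangentMap (by simp)
  have h2 : ContMDiff 𝓘(ℝ, V) 𝓘(ℝ, V).tangent ∞
      (fun p : V => (⟨p, v⟩ : TangentBundle 𝓘(ℝ, V) V)) :=
    contMDiff_vectorSpace_iff_contDiff.2 contDiff_const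
  exact (A.smooth.comp (h1.comp h2)).contDiff

lemma contDiff_pullback {V : Type*} [NormedAddCommGroup V] [NormedSpace ℝ V]
    [FiniteDimensional ℝ V] {c : V → M}
    (hc : ContMDiff 𝓘(ℝ, V) 𝓘(ℝ, E) ∞ c) : ContDiff ℝ ∞ (A.pullback c) :=
  contDiff_clm_apply_iff.2 fun v => A.contDiff_pullback_apply hc v

lemma pullback_comp {V W : Type*} [NormedAddCommGroup V] [NormedSpace ℝ V]
    [NormedAddCommGroup W] [NormedSpace ℝ W] {c : V → M} {f : W → V} {p : W}
    (hc : MDifferentiableAt 𝓘(ℝ, V) 𝓘(ℝ, E) c (f p)) (hf : DifferentiableAt ℝ f p) :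
    A.pullback (fun q => c (f q)) p = (A.pullback c (f p)).comp (fderiv ℝ f p) := by
  have h : mfderiv 𝓘(ℝ, W) 𝓘(ℝ, E) (c ∘ f) p = _ := mfderiv_comp p hc hf.mdifferentiableAt
  ext w
  change A.form (c (f p)) (mfderiv 𝓘(ℝ, W) 𝓘(ℝ, E) (c ∘ f) p w) = _
  rw [h, mfderiv_eq_fderiv]
  rfl

lemma pullback_congr {V : Type*} [NormedAddCommGroup V] [NormedSpace ℝ V] {c c' : V → M} {p : V}
    (h : c =ᶠ[𝓝 p] c') : A.pullback c p = A.pullback c' p := by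
  have h1 : c p = c' p := h.eq_of_nhds
  have h2 := h.mfderiv_eq (I := 𝓘(ℝ, V)) (I' := 𝓘(ℝ, E))
  ext v
  rw [pullback_apply, pullback_apply]
  -- The tangent spaces at c p and c' p are different types with the same model E, so the base point
  -- is replaced while the vector is held as an element of E.
  have : ∀ (x y : M) (w : E), x = y → A.form x w = A.form y w := by
    rintro x _ w rfl
    rfl
  exact (this _ _ _ h1).trans (congrArg (A.form (c' p)) (congrArg (fun L : V →L[ℝ] E => L v) h2))

lemma pullback_const {V : Type*} [NormedAddCommGroup V] [NormedSpace ℝ V] (x : M) (p : V) :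
    A.pullback (fun _ => x) p = 0 := by
  ext v
  rw [pullback_apply, mfderiv_const]
  exact map_zero (A.form x)

/-! ### Parallel transport -/

/-- The infinitesimal transport along a curve. -/
def velocity (c : ℝ → M) (t : ℝ) : E' := A.pullback c t 1

lemma contDiff_velocity {c : ℝ → M} (hc : ContMDiff 𝓘(ℝ, ℝ) 𝓘(ℝ, E) ∞ c) :
    ContDiff ℝ ∞ (A.velocity c) := A.contDiff_pullback_apply hc 1

lemma velocity_comp {c : ℝ → M} (hc : ContMDiff 𝓘(ℝ, ℝ) 𝓘(ℝ, E) ∞ c) {φ : ℝ → ℝ} {r t : ℝ}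
    (hφ : HasDerivAt φ r t) : A.velocity (fun s => c (φ s)) t = r • A.velocity c (φ t) := by
  rw [velocity, A.pullback_comp (hc.mdifferentiableAt (by simp)) hφ.differentiableAt,
    ContinuousLinearMap.comp_apply, hφ.hasFDerivAt.fderiv, velocity, ← map_smul]
  simp

lemma velocity_slice_right {W : Type*} [NormedAddCommGroup W] [NormedSpace ℝ W] {c : W × ℝ → M}
    (hc : ContMDiff 𝓘(ℝ, W × ℝ) 𝓘(ℝ, E) ∞ c) (w : W) (t : ℝ) :
    A.velocity (fun t : ℝ => c (w, t)) t = A.pullback c (w, t) (0, 1) := by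
  have : HasFDerivAt (fun t : ℝ => (w, t)) (ContinuousLinearMap.inr ℝ W ℝ) t :=
    hasFDerivAt_prodMk_right w t
  rw [velocity, A.pullback_comp (f := fun t : ℝ => (w, t)) (hc.mdifferentiableAt (by simp))
    this.differentiableAt, ContinuousLinearMap.comp_apply, this.fderiv]
  rfl

lemma velocity_slice_left {W : Type*} [NormedAddCommGroup W] [NormedSpace ℝ W] {c : ℝ × W → M}
    (hc : ContMDiff 𝓘(ℝ, ℝ × W) 𝓘(ℝ, E) ∞ c) (w : W) (s : ℝ) :
    A.velocity (fun s : ℝ => c (s, w)) s = A.pullback c (s, w) (1, 0) := by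
  have : HasFDerivAt (fun s : ℝ => (s, w)) (ContinuousLinearMap.inl ℝ ℝ W) s :=
    hasFDerivAt_prodMk_left s w
  rw [velocity, A.pullback_comp (f := fun s : ℝ => (s, w)) (hc.mdifferentiableAt (by simp))
    this.differentiableAt, ContinuousLinearMap.comp_apply, this.fderiv]
  rfl

variable [LieGroup 𝓘(ℝ, E') ∞ G]

lemma isParallelTransport_iff {x y : M} {γ : LazyPath 𝓘(ℝ, E) x y} {g : ℝ → G} :
    IsParallelTransport A γ g ↔
      g 0 = 1 ∧ ∀ t, HasRightLogDerivAt g (A.velocity γ t) t := by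
  simp only [hasRightLogDerivAt_iff_tangentMap]
  constructor
  · rintro ⟨h1, h2, h3⟩
    exact ⟨h2, fun t => ⟨h1 t, h3 t⟩⟩
  · rintro ⟨h2, h3⟩
    exact ⟨fun t => (h3 t).1, h2, fun t => (h3 t).2⟩

variable [FiniteDimensional ℝ E']

lemma exists_transport (c : ℝ → M) (hc : ContMDiff 𝓘(ℝ, ℝ) 𝓘(ℝ, E) ∞ c) :
    ∃ g : ℝ → G, g 0 = 1 ∧ ∀ t, HasRightLogDerivAt g (A.velocity c t) t :=
  exists_evolution (A.contDiff_velocity hc)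

/-- Parallel transport along a smooth curve, starting at time `0`. -/
def transport (c : ℝ → M) (hc : ContMDiff 𝓘(ℝ, ℝ) 𝓘(ℝ, E) ∞ c) : ℝ → G :=
  (A.exists_transport c hc).choose

lemma transport_zero {c : ℝ → M} (hc : ContMDiff 𝓘(ℝ, ℝ) 𝓘(ℝ, E) ∞ c) :
    A.transport c hc 0 = 1 := (A.exists_transport c hc).choose_spec.1

lemma hasRightLogDerivAt_transport {c : ℝ → M} (hc : ContMDiff 𝓘(ℝ, ℝ) 𝓘(ℝ, E) ∞ c) (t : ℝ) :
    HasRightLogDerivAt (A.transport c hc) (A.velocity c t) t :=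
  (A.exists_transport c hc).choose_spec.2 t

lemma eq_transport {c : ℝ → M} (hc : ContMDiff 𝓘(ℝ, ℝ) 𝓘(ℝ, E) ∞ c) {g : ℝ → G}
    (h0 : g 0 = 1) (hg : ∀ t, HasRightLogDerivAt g (A.velocity c t) t) :
    g = A.transport c hc := by
  funext t
  exact eqOn_of_hasRightLogDerivAt isOpen_univ isPreconnected_univ (fun t _ => hg t)
    (fun t _ => A.hasRightLogDerivAt_transport hc t) (mem_univ 0)
    (h0.trans (A.transport_zero hc).symm) (mem_univ t)

lemma isParallelTransport_transport {x y : M} (γ : LazyPath 𝓘(ℝ, E) x y) :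
    IsParallelTransport A γ (A.transport γ γ.smooth) :=
  A.isParallelTransport_iff.2 ⟨A.transport_zero _, A.hasRightLogDerivAt_transport _⟩

lemma eq_transport_of_isParallelTransport {x y : M} {γ : LazyPath 𝓘(ℝ, E) x y} {g : ℝ → G}
    (h : IsParallelTransport A γ g) : g = A.transport γ γ.smooth :=
  A.eq_transport _ (A.isParallelTransport_iff.1 h).1 (A.isParallelTransport_iff.1 h).2

/-- Reparametrization of parallel transport. -/
lemma transport_comp {c : ℝ → M} (hc : ContMDiff 𝓘(ℝ, ℝ) 𝓘(ℝ, E) ∞ c) {φ : ℝ → ℝ}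
    (hφ : ContDiff ℝ ∞ φ) (t : ℝ) :
    A.transport (fun s => c (φ s)) (hc.comp hφ.contMDiff) t =
      A.transport c hc (φ t) * (A.transport c hc (φ 0))⁻¹ := by
  have : IsTopologicalGroup G := topologicalGroup_of_lieGroup 𝓘(ℝ, E') ∞
  refine (congrFun (A.eq_transport (c := fun s => c (φ s)) (hc.comp hφ.contMDiff)
    (g := fun t => A.transport c hc (φ t) * (A.transport c hc (φ 0))⁻¹) (by simp)
    fun t => ?_) t).symm
  have hd : HasDerivAt φ (deriv φ t) t := (hφ.differentiable (by simp) t).hasDerivAt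
  rw [A.velocity_comp hc hd]
  exact ((A.hasRightLogDerivAt_transport hc (φ t)).scomp hd).mul_const _

/-- Parallel transport depends smoothly on parameters. -/
lemma contMDiff_transport {W : Type} [NormedAddCommGroup W] [NormedSpace ℝ W] {c : W × ℝ → M}
    (hc : ContMDiff 𝓘(ℝ, W × ℝ) 𝓘(ℝ, E) ∞ c) :
    ContMDiff 𝓘(ℝ, W × ℝ) 𝓘(ℝ, E') ∞ (fun p : W × ℝ => A.transport (fun t => c (p.1, t))
      (hc.comp (contDiff_const.prodMk contDiff_id).contMDiff) p.2) := by
  refine contMDiff_evolution (A.contDiff_pullback_apply hc (0, 1)) (fun w => A.transport_zero _)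
    fun w t => ?_
  rw [← A.velocity_slice_right hc]
  exact A.hasRightLogDerivAt_transport
    (hc.comp (contDiff_const.prodMk contDiff_id (f := fun _ : ℝ => w)).contMDiff) t

end TrivialBundleConnection

end Transport
end

noncomputable section

/-! ### The Maurer-Cartan equation and invariance under thin homotopies. -/

section ThinInvariance

open Set Filter Topology

universe v

/-- Grönwall: on the compact interval [0, t] the operators L are bounded by some K, so ‖η'‖ ≤ K‖η‖
with η(0) = 0. -/
lemma eq_zero_of_hasDerivAt_clm {F : Type*} [NormedAddCommGroup F] [NormedSpace ℝ F]
    {L : ℝ → F →L[ℝ] F} (hL : Continuous L) {η : ℝ → F} (h0 : η 0 = 0)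
    (hη : ∀ t, HasDerivAt η (L t (η t)) t) {t : ℝ} (ht : 0 ≤ t) : η t = 0 := by
  obtain ⟨K, hK⟩ := (isCompact_Icc (a := 0) (b := t)).exists_bound_of_continuousOn hL.continuousOn
  exact eq_zero_of_abs_deriv_le_mul_abs_self_of_eq_zero_right
    (fun s _ => (hη s).continuousAt.continuousWithinAt) (fun s _ => (hη s).hasDerivWithinAt) h0
    (fun s hs => (L s).le_of_opNorm_le (hK s (Ico_subset_Icc_self hs)) _) t ⟨ht, le_rfl⟩

/-- The antisymmetric part of a bilinear map vanishes on dependent vectors. This is how rank less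
than two enters, both for closedness of the pulled-back form and for the bracket term. -/
lemma clm_apply_comm_of_dependent {F F' : Type*} [NormedAddCommGroup F] [NormedSpace ℝ F]
    [NormedAddCommGroup F'] [NormedSpace ℝ F'] (β : F →L[ℝ] F →L[ℝ] F') {v w : F} {k : ℝ × ℝ}
    (hk : k ≠ 0) (h : k.1 • v + k.2 • w = 0) : β v w = β w v := by
  have h1 : k.1 • β v w = k.1 • β w v := by
    have e : k.1 • v = -(k.2 • w) := eq_neg_of_add_eq_zero_left h
    calc k.1 • β v w = β (k.1 • v) w := by simp
      _ = β w (k.1 • v) := by rw [e]; simp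
      _ = k.1 • β w v := by simp
  have h2 : k.2 • β v w = k.2 • β w v := by
    have e : k.2 • w = -(k.1 • v) := eq_neg_of_add_eq_zero_right h
    calc k.2 • β v w = β v (k.2 • w) := by simp
      _ = β (k.2 • w) v := by rw [e]; simp
      _ = k.2 • β w v := by simp
  by_cases hk1 : k.1 = 0
  · have hk2 : k.2 ≠ 0 := fun hk2 => hk (Prod.ext hk1 hk2)
    exact smul_right_injective _ hk2 h2
  · exact smul_right_injective _ hk1 h1

lemma hasDerivAt_slice_left {F : Type*} [NormedAddCommGroup F] [NormedSpace ℝ F] {f : ℝ × ℝ → F}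
    {s t : ℝ} (hf : DifferentiableAt ℝ f (s, t)) :
    HasDerivAt (fun s => f (s, t)) (fderiv ℝ f (s, t) (1, 0)) s :=
  HasFDerivAt.comp_hasDerivAt (l := f) (f := fun s => (s, t)) s hf.hasFDerivAt
    ((hasDerivAt_id s).prodMk (hasDerivAt_const s t))

lemma hasDerivAt_slice_right {F : Type*} [NormedAddCommGroup F] [NormedSpace ℝ F] {f : ℝ × ℝ → F}
    {s t : ℝ} (hf : DifferentiableAt ℝ f (s, t)) :
    HasDerivAt (fun t => f (s, t)) (fderiv ℝ f (s, t) (0, 1)) t :=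
  HasFDerivAt.comp_hasDerivAt (l := f) (f := fun t => (s, t)) t hf.hasFDerivAt
    ((hasDerivAt_const t s).prodMk (hasDerivAt_id t))

lemma ContDiffAt.isSymmSndFDerivAt_of_infty {V F : Type*} [NormedAddCommGroup V] [NormedSpace ℝ V]
    [NormedAddCommGroup F] [NormedSpace ℝ F] {f : V → F} {p : V} (hf : ContDiffAt ℝ ∞ f p) :
    IsSymmSndFDerivAt ℝ f p := by
  refine hf.isSymmSndFDerivAt ?_
  rw [minSmoothness_of_isRCLikeNormedField]
  exact WithTop.coe_le_coe.2 (le_top : (2 : ℕ∞) ≤ ⊤)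

/-! ### The Maurer-Cartan equation -/

section MaurerCartan

variable {E' : Type*} [NormedAddCommGroup E'] [NormedSpace ℝ E']
  {G : Type*} [TopologicalSpace G] [ChartedSpace E' G] [Group G] [LieGroup 𝓘(ℝ, E') ∞ G]

/-- The logarithmic derivative is a partial derivative of (p, s) ↦ g(s, w)g(p)⁻¹ in the chart,
evaluated where this equals 1, so it is smooth in p. -/
lemma exists_contDiff_hasRightLogDerivAt {W : Type*} [NormedAddCommGroup W] [NormedSpace ℝ W]
    {g : ℝ × W → G} (hg : ContMDiff 𝓘(ℝ, ℝ × W) 𝓘(ℝ, E') ∞ g) :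
    ∃ ξ : ℝ × W → E', ContDiff ℝ ∞ ξ ∧
      ∀ s w, HasRightLogDerivAt (fun s => g (s, w)) (ξ (s, w)) s := by
  let f : ℝ × W → ℝ → E' := fun p s => chartOne E' G (g (s, p.2) * (g p)⁻¹)
  have hf : ∀ p : ℝ × W, ContDiffAt ℝ ∞ (Function.uncurry f) (p, p.1) := by
    intro p
    rw [← contMDiffAt_iff_contDiffAt]
    have h1 : ContMDiff 𝓘(ℝ, (ℝ × W) × ℝ) 𝓘(ℝ, E') ∞
        (fun q : (ℝ × W) × ℝ => g (q.2, q.1.2) * (g q.1)⁻¹) :=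
      (hg.comp (contDiff_snd.prodMk (contDiff_snd.comp contDiff_fst)).contMDiff).mul
        (hg.comp contDiff_fst.contMDiff).inv
    exact (contMDiffAt_chartOne (by simp)).comp (p, p.1) h1.contMDiffAt
  refine ⟨fun p => fderiv ℝ (f p) p.1 1, contDiff_iff_contDiffAt.2 fun p =>
    (ContDiffAt.fderiv (hf p) contDiffAt_fst (by simp)).clm_apply contDiffAt_const, fun s w => ?_⟩
  refine ⟨(hg.continuous.comp (by fun_prop : Continuous fun s : ℝ => (s, w))).continuousAt, ?_⟩
  have h2 : ContDiffAt ℝ ∞ (f (s, w)) s :=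
    ContDiffAt.comp s (f := fun r : ℝ => ((s, w), r)) (hf (s, w))
      (contDiffAt_const.prodMk contDiffAt_id)
  exact (h2.differentiableAt (by simp)).hasDerivAt

/-- The Maurer-Cartan equation for the logarithmic derivatives of a map from the plane. -/
lemma maurerCartan {g : ℝ × ℝ → G} (hg : ContMDiff 𝓘(ℝ, ℝ × ℝ) 𝓘(ℝ, E') ∞ g)
    {ξ b : ℝ × ℝ → E'} (hξ : Differentiable ℝ ξ) (hb : Differentiable ℝ b)
    (hgξ : ∀ s t, HasRightLogDerivAt (fun s => g (s, t)) (ξ (s, t)) s)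
    (hgb : ∀ s t, HasRightLogDerivAt (fun t => g (s, t)) (b (s, t)) t) (p : ℝ × ℝ) :
    fderiv ℝ (rightTranslation E' G) (chartOne E' G 1) (ξ p) (b p) + fderiv ℝ b p (1, 0) =
      fderiv ℝ (rightTranslation E' G) (chartOne E' G 1) (b p) (ξ p) + fderiv ℝ ξ p (0, 1) := by
  have : IsTopologicalGroup G := topologicalGroup_of_lieGroup 𝓘(ℝ, E') ∞
  -- Translation by (g p)⁻¹ preserves both logarithmic derivatives and centres g at the identity,
  -- where `rightTranslation` is the identity map.
  let x : ℝ × ℝ → E' := fun q => chartOne E' G (g q * (g p)⁻¹)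
  have hgp : ContMDiff 𝓘(ℝ, ℝ × ℝ) 𝓘(ℝ, E') ∞ (fun q => g q * (g p)⁻¹) := hg.mul contMDiff_const
  have hxp : x p = chartOne E' G 1 := by simp [x]
  have hsource : ∀ᶠ q in 𝓝 p, g q * (g p)⁻¹ ∈ (chartOne E' G).source :=
    hgp.continuous.continuousAt.preimage_mem_nhds (isOpen_chartOne_source.mem_nhds (by simp))
  have hx : ∀ q, g q * (g p)⁻¹ ∈ (chartOne E' G).source → ContDiffAt ℝ ∞ x q := fun q hq =>
    ((contMDiffAt_chartOne hq).comp q hgp.contMDiffAt).contDiffAt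
  have hxs : ∀ q, g q * (g p)⁻¹ ∈ (chartOne E' G).source →
      fderiv ℝ x q (1, 0) = rightTranslation E' G (x q) (ξ q) := by
    intro q hq
    exact (hasDerivAt_slice_left ((hx q hq).differentiableAt (by simp))).unique
      (((hgξ q.1 q.2).mul_const (g p)⁻¹).hasDerivAt_chartOne hq)
  have hxt : ∀ q, g q * (g p)⁻¹ ∈ (chartOne E' G).source →
      fderiv ℝ x q (0, 1) = rightTranslation E' G (x q) (b q) := by
    intro q hq
    exact (hasDerivAt_slice_right ((hx q hq).differentiableAt (by simp))).unique
      (((hgb q.1 q.2).mul_const (g p)⁻¹).hasDerivAt_chartOne hq)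
  have hp : g p * (g p)⁻¹ ∈ (chartOne E' G).source := hsource.self_of_nhds
  have hsymm : IsSymmSndFDerivAt ℝ x p := (hx p hp).isSymmSndFDerivAt_of_infty
  have hx' : HasFDerivAt x (fderiv ℝ x p) p := ((hx p hp).differentiableAt (by simp)).hasFDerivAt
  have hx'' : HasFDerivAt (fderiv ℝ x) (fderiv ℝ (fderiv ℝ x) p) p :=
    (((hx p hp).fderiv_right (m := ∞) (by simp)).differentiableAt (by simp)).hasFDerivAt
  have hR : HasFDerivAt (rightTranslation E' G)
      (fderiv ℝ (rightTranslation E' G) (chartOne E' G 1)) (x p) := by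
    rw [hxp]
    exact ((contDiffAt_rightTranslation chartOne_one_mem_target).differentiableAt
      (by simp)).hasFDerivAt
  have hRx := hR.comp p hx'
  -- Differentiate ∂ₑx = R(x)c once more in the direction u at p. The two mixed second derivatives
  -- so obtained are equal by symmetry, which is the assertion.
  have key : ∀ (e u : ℝ × ℝ) (c : ℝ × ℝ → E'), Differentiable ℝ c →
      (∀ q, g q * (g p)⁻¹ ∈ (chartOne E' G).source →
        fderiv ℝ x q e = rightTranslation E' G (x q) (c q)) →
      fderiv ℝ (fderiv ℝ x) p u e =
        fderiv ℝ (rightTranslation E' G) (chartOne E' G 1) (fderiv ℝ x p u) (c p) +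
          fderiv ℝ c p u := by
    intro e u c hc hxc
    have h1 : HasFDerivAt (fun q => fderiv ℝ x q e) _ p := hx''.clm_apply (hasFDerivAt_const e p)
    have h2 := (hRx.clm_apply (hc p).hasFDerivAt).congr_of_eventuallyEq
      (hsource.mono fun q hq => hxc q hq)
    have h3 := congrArg (fun L => L u) (h1.unique h2)
    simp only [add_apply, ContinuousLinearMap.comp_apply,
      ContinuousLinearMap.flip_apply, zero_apply, map_zero, zero_add,
      Function.comp_apply, hxp, rightTranslation_one, ContinuousLinearMap.id_apply] at h3
    rw [h3, add_comm]
  have h1 := key (0, 1) (1, 0) b hb hxt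
  have h2 := key (1, 0) (0, 1) ξ hξ hxs
  rw [hxs p hp, hxp, rightTranslation_one, ContinuousLinearMap.id_apply] at h1
  rw [hxt p hp, hxp, rightTranslation_one, ContinuousLinearMap.id_apply] at h2
  rw [← h1, ← h2]
  exact hsymm _ _

end MaurerCartan

/-! ### Smooth local parametrizations -/

section Manifold

variable {E : Type*} [NormedAddCommGroup E] [NormedSpace ℝ E] [FiniteDimensional ℝ E]
  {M : Type*} [TopologicalSpace M] [ChartedSpace E M] [IsManifold 𝓘(ℝ, E) ∞ M]

/-- The inverse of a chart, modified away from the base point so as to be defined everywhere. -/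
lemma exists_contMDiff_localInverse (x : M) : ∃ ψ : E → M, ContMDiff 𝓘(ℝ, E) 𝓘(ℝ, E) ∞ ψ ∧
    (∀ᶠ y in 𝓝 x, ψ (extChartAt 𝓘(ℝ, E) x y) = y) ∧
    ∀ᶠ z in 𝓝 (extChartAt 𝓘(ℝ, E) x x), extChartAt 𝓘(ℝ, E) x (ψ z) = z := by
  have htarget := extChartAt_target_mem_nhds (I := 𝓘(ℝ, E)) x
  obtain ⟨ρ, hρ, hρid, hρU⟩ := exists_contDiff_eventuallyEq_id htarget
  refine ⟨fun z => (extChartAt 𝓘(ℝ, E) x).symm (ρ z), ?_, ?_, ?_⟩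
  · intro z
    exact ((contMDiffOn_extChartAt_symm (n := ∞) x).contMDiffAt
      ((isOpen_extChartAt_target x).mem_nhds (hρU z))).comp z hρ.contMDiff.contMDiffAt
  · filter_upwards [(continuousAt_extChartAt (I := 𝓘(ℝ, E)) x).eventually hρid,
      extChartAt_source_mem_nhds (I := 𝓘(ℝ, E)) x] with y hy hy'
    rw [hy, id, (extChartAt 𝓘(ℝ, E) x).left_inv hy']
  · filter_upwards [hρid, htarget] with z hz hz'
    rw [hz, id, (extChartAt 𝓘(ℝ, E) x).right_inv hz']

end Manifold

/-! ### Flatness along thin maps -/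

variable {E : Type*} [NormedAddCommGroup E] [NormedSpace ℝ E] [FiniteDimensional ℝ E]
  {M : Type*} [TopologicalSpace M] [ChartedSpace E M] [IsManifold 𝓘(ℝ, E) ∞ M]
  {E' : Type v} [NormedAddCommGroup E'] [NormedSpace ℝ E']
  {G : Type*} [TopologicalSpace G] [ChartedSpace E' G] [Group G]

omit [FiniteDimensional ℝ E] [IsManifold 𝓘(ℝ, E) ∞ M] in
lemma IsThin.exists_mfderiv_eq_zero {h : ℝ × ℝ → M} (hh : IsThin 𝓘(ℝ, E) h) (p : ℝ × ℝ) :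
    ∃ k : ℝ × ℝ, k ≠ 0 ∧ mfderiv 𝓘(ℝ, ℝ × ℝ) 𝓘(ℝ, E) h p k = 0 := by
  by_contra! hne
  have h1 := hh.rank_lt p
  let L : (ℝ × ℝ) →ₗ[ℝ] E := (mfderiv 𝓘(ℝ, ℝ × ℝ) 𝓘(ℝ, E) h p).toLinearMap
  have hinj : Function.Injective L := by
    rw [injective_iff_map_eq_zero]
    intro k hk
    by_contra hk0
    exact hne k hk0 hk
  have h2 : Module.finrank ℝ (LinearMap.range L) = 2 := by
    rw [LinearMap.finrank_range_of_inj hinj]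
    simp
  have h3 : Module.finrank ℝ (LinearMap.range L) < 2 := h1
  omega

namespace TrivialBundleConnection

variable (A : TrivialBundleConnection 𝓘(ℝ, E) M 𝓘(ℝ, E') G)

/-- The pull-back of a connection along a thin map is closed. -/
lemma fderiv_pullback_of_isThin {h : ℝ × ℝ → M} (hh : IsThin 𝓘(ℝ, E) h) (p : ℝ × ℝ) :
    fderiv ℝ (fun q => A.pullback h q (1, 0)) p (0, 1) =
      fderiv ℝ (fun q => A.pullback h q (0, 1)) p (1, 0) := by
  obtain ⟨ψ, hψ, hψinv, -⟩ := exists_contMDiff_localInverse (E := E) (h p)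
  let k : ℝ × ℝ → E := fun q => extChartAt 𝓘(ℝ, E) (h p) (h q)
  have hk : ContDiffAt ℝ ∞ k p :=
    (contMDiffAt_extChartAt.comp p (hh.smooth p)).contDiffAt
  have hev : ∀ᶠ q in 𝓝 p, h q = ψ (k q) :=
    (hh.smooth.continuous.continuousAt.eventually hψinv).mono fun q hq => hq.symm
  have hkd : ∀ᶠ q in 𝓝 p, DifferentiableAt ℝ k q :=
    ((hk.of_le (m := 1) (by simp)).eventually (by simp)).mono fun q hq =>
      hq.differentiableAt (by simp)
  have hpull : ∀ᶠ q in 𝓝 p, A.pullback h q = (A.pullback ψ (k q)).comp (fderiv ℝ k q) := by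
    filter_upwards [hev.eventually_nhds, hkd] with q hq hq'
    rw [A.pullback_congr hq]
    exact A.pullback_comp (hψ.mdifferentiableAt (by simp)) hq'
  have hω := ((A.contDiff_pullback hψ).differentiable (by simp) (k p)).hasFDerivAt
  have hk' : HasFDerivAt k (fderiv ℝ k p) p := (hk.differentiableAt (by simp)).hasFDerivAt
  have hk'' : HasFDerivAt (fderiv ℝ k) (fderiv ℝ (fderiv ℝ k) p) p :=
    ((hk.fderiv_right (m := ∞) (by simp)).differentiableAt (by simp)).hasFDerivAt
  -- Of the two terms, the one with the second derivative of k is symmetric in e and u for every h;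
  -- only the other one needs thinness.
  have key : ∀ e u : ℝ × ℝ, fderiv ℝ (fun q => A.pullback h q e) p u =
      A.pullback ψ (k p) (fderiv ℝ (fderiv ℝ k) p u e) +
        fderiv ℝ (A.pullback ψ) (k p) (fderiv ℝ k p u) (fderiv ℝ k p e) := by
    intro e u
    have h1 := (hω.comp p hk').clm_apply (hk''.clm_apply (hasFDerivAt_const e p))
    have h2 := h1.congr_of_eventuallyEq (f₁ := fun q => A.pullback h q e)
      (hpull.mono fun q hq => by simp [hq])
    rw [h2.fderiv]
    simp
  rw [key, key, hk.isSymmSndFDerivAt_of_infty (0, 1) (1, 0)]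
  congr 1
  obtain ⟨u, hu, hu0⟩ := hh.exists_mfderiv_eq_zero p
  -- The coordinates of the kernel vector are swapped because the first argument here is the
  -- derivative of k along (0, 1).
  refine clm_apply_comm_of_dependent _ (k := (u.2, u.1)) (fun h0 => hu ?_) ?_
  · rw [Prod.mk_eq_zero] at h0
    exact Prod.ext h0.2 h0.1
  · have h1 : mfderiv 𝓘(ℝ, ℝ × ℝ) 𝓘(ℝ, E) k p = _ :=
      mfderiv_comp p ((contMDiffAt_extChartAt (n := ∞)).mdifferentiableAt (by simp))
        ((hh.smooth p).mdifferentiableAt (by simp))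
    have h2 : fderiv ℝ k p u = 0 := by
      rw [← mfderiv_eq_fderiv, h1]
      change mfderiv 𝓘(ℝ, E) 𝓘(ℝ, E) (extChartAt 𝓘(ℝ, E) (h p)) (h p)
        (mfderiv 𝓘(ℝ, ℝ × ℝ) 𝓘(ℝ, E) h p u) = 0
      rw [hu0, map_zero]
    have h3 : u = u.1 • ((1, 0) : ℝ × ℝ) + u.2 • ((0, 1) : ℝ × ℝ) := by ext <;> simp
    rw [h3, map_add, map_smul, map_smul] at h2
    rw [add_comm]
    simpa using h2

variable [LieGroup 𝓘(ℝ, E') ∞ G] [FiniteDimensional ℝ E']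

omit [FiniteDimensional ℝ E] in
lemma transport_congr {c c' : ℝ → M} (hc : ContMDiff 𝓘(ℝ, ℝ) 𝓘(ℝ, E) ∞ c)
    (hc' : ContMDiff 𝓘(ℝ, ℝ) 𝓘(ℝ, E) ∞ c') (h : ∀ t, c t = c' t) :
    A.transport c hc = A.transport c' hc' := by
  obtain rfl : c = c' := funext h
  rfl

/-- Parallel transport is invariant under thin homotopies. -/
lemma transport_eq_of_thinHomotopic {x y : M} {γ δ : LazyPath 𝓘(ℝ, E) x y}
    (hγδ : ThinHomotopic 𝓘(ℝ, E) γ δ) :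
    A.transport γ γ.smooth 1 = A.transport δ δ.smooth 1 := by
  obtain ⟨h, hh, ε, hε, hγ, hδ, hx, hy⟩ := hγδ
  let B := fderiv ℝ (rightTranslation E' G) (chartOne E' G 1)
  let a : ℝ × ℝ → E' := fun p => A.pullback h p (1, 0)
  let b : ℝ × ℝ → E' := fun p => A.pullback h p (0, 1)
  have ha : ContDiff ℝ ∞ a := A.contDiff_pullback_apply hh.smooth _
  have hb : ContDiff ℝ ∞ b := A.contDiff_pullback_apply hh.smooth _
  have hslice : ∀ s : ℝ, ContMDiff 𝓘(ℝ, ℝ) 𝓘(ℝ, E) ∞ (fun t : ℝ => h (s, t)) := fun s =>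
    hh.smooth.comp (contDiff_const.prodMk contDiff_id).contMDiff
  let g : ℝ × ℝ → G := fun p => A.transport (fun t => h (p.1, t)) (hslice p.1) p.2
  have hg : ContMDiff 𝓘(ℝ, ℝ × ℝ) 𝓘(ℝ, E') ∞ g := A.contMDiff_transport hh.smooth
  have hgb : ∀ s t, HasRightLogDerivAt (fun t => g (s, t)) (b (s, t)) t := fun s t => by
    have := A.hasRightLogDerivAt_transport (hslice s) t
    rwa [A.velocity_slice_right hh.smooth] at this
  obtain ⟨ξ, hξ, hgξ⟩ := exists_contDiff_hasRightLogDerivAt hg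
  have hcomm : ∀ p, B (a p) (b p) = B (b p) (a p) := by
    intro p
    obtain ⟨u, hu, hu0⟩ := hh.exists_mfderiv_eq_zero p
    refine clm_apply_comm_of_dependent B hu ?_
    have h1 : A.pullback h p u = 0 := by
      rw [pullback_apply, hu0]
      exact map_zero (A.form (h p))
    have h3 : u = u.1 • ((1, 0) : ℝ × ℝ) + u.2 • ((0, 1) : ℝ × ℝ) := by ext <;> simp
    rw [h3, map_add, map_smul, map_smul] at h1
    exact h1
  have hzero : ∀ t z, (∀ s, h (s, t) = z) → ∀ s, a (s, t) = 0 := by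
    intro t z ht s
    change A.pullback h (s, t) (1, 0) = 0
    rw [← A.velocity_slice_left hh.smooth, velocity,
      A.pullback_congr (c' := fun _ => z) (Eventually.of_forall ht), A.pullback_const]
    rfl
  -- The difference η = ξ - a satisfies ∂η/∂t = B(η, b) - B(b, η): take Maurer-Cartan for ξ and b,
  -- subtract ∂a/∂t = ∂b/∂s, and use B(a, b) = B(b, a). At t = 0 both ξ and a vanish, since g(s,0) =
  -- 1 and h(s,0) = x.
  have hξa : ∀ s, ξ (s, 1) = a (s, 1) := by
    intro s
    let L : ℝ → E' →L[ℝ] E' := fun t => B.flip (b (s, t)) - B (b (s, t))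
    have hbs : Continuous fun t => b (s, t) := hb.continuous.comp (Continuous.prodMk_right s)
    have hL : Continuous L :=
      (B.flip.continuous.comp hbs).sub (B.continuous.comp hbs)
    have h0 : ξ (s, 0) - a (s, 0) = 0 := by
      rw [hzero 0 x (fun s => hx s 0 hε.le) s, sub_zero]
      refine (hgξ s 0).unique ?_
      have : (fun s => g (s, 0)) = fun _ => 1 := funext fun s => A.transport_zero _
      rw [this]
      exact hasRightLogDerivAt_const _ _
    refine sub_eq_zero.1 (eq_zero_of_hasDerivAt_clm hL (η := fun t => ξ (s, t) - a (s, t)) h0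
      (fun t => ?_) zero_le_one)
    have hd : HasDerivAt (fun t => ξ (s, t) - a (s, t)) _ t :=
      (hasDerivAt_slice_right (hξ.differentiable (by simp) (s, t))).sub
        (hasDerivAt_slice_right (ha.differentiable (by simp) (s, t)))
    convert hd using 1
    have hmc := maurerCartan hg (hξ.differentiable (by simp)) (hb.differentiable (by simp)) hgξ hgb
      (s, t)
    have hflat : fderiv ℝ a (s, t) (0, 1) = fderiv ℝ b (s, t) (1, 0) :=
      A.fderiv_pullback_of_isThin hh (s, t)
    rw [hflat, ← sub_eq_zero]
    simp only [L, sub_apply, ContinuousLinearMap.flip_apply, map_sub]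
    rw [hcomm (s, t)]
    rw [← sub_eq_zero] at hmc
    rw [← hmc]
    simp only [B]
    abel
  have hconst : g (0, 1) = g (1, 1) := by
    refine eq_of_hasRightLogDerivAt_zero (q := fun s => g (s, 1)) (E' := E') isOpen_univ
      isPreconnected_univ (fun s _ => ?_) (mem_univ 0) (mem_univ 1)
    have := hgξ s 1
    rwa [hξa, hzero 1 y (fun s => hy s 1 (by linarith)) s] at this
  have e0 : A.transport (fun t => h (0, t)) (hslice 0) = A.transport γ γ.smooth :=
    A.transport_congr _ _ fun t => hγ 0 t hε.le
  have e1 : A.transport (fun t => h (1, t)) (hslice 1) = A.transport δ δ.smooth :=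
    A.transport_congr _ _ fun t => hδ 1 t (by linarith)
  rw [← e0, ← e1]
  exact hconst

end TrivialBundleConnection

end ThinInvariance
end

noncomputable section

/-! ### From a connection to its smooth functor. -/

section HolonomyFunctor

open Set Filter Topology CategoryTheory

universe v

variable {E : Type*} [NormedAddCommGroup E] [NormedSpace ℝ E] [FiniteDimensional ℝ E]
  {M : Type*} [TopologicalSpace M] [ChartedSpace E M] [IsManifold 𝓘(ℝ, E) ∞ M]
  {E' : Type v} [NormedAddCommGroup E'] [NormedSpace ℝ E'] [FiniteDimensional ℝ E']
  {G : Type*} [TopologicalSpace G] [ChartedSpace E' G] [Group G] [LieGroup 𝓘(ℝ, E') ∞ G]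

namespace TrivialBundleConnection

variable (A : TrivialBundleConnection 𝓘(ℝ, E) M 𝓘(ℝ, E') G)

/-! ### The holonomy functor of a connection -/

omit [FiniteDimensional ℝ E] in
lemma transport_const (x : M) (t : ℝ) :
    A.transport (fun _ => x) contMDiff_const t = 1 := by
  refine (congrFun (A.eq_transport contMDiff_const (g := fun _ => 1) rfl fun t => ?_) t).symm
  rw [velocity, pullback_const]
  exact hasRightLogDerivAt_const 1 t

-- Transport from t₀ to t₁ depends only on the curve near the times in between: both sides solve the
-- same equation on s with value 1 at t₀.
omit [FiniteDimensional ℝ E] in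
lemma transport_mul_inv_of_eqOn {c c' : ℝ → M} (hc : ContMDiff 𝓘(ℝ, ℝ) 𝓘(ℝ, E) ∞ c)
    (hc' : ContMDiff 𝓘(ℝ, ℝ) 𝓘(ℝ, E) ∞ c') {s : Set ℝ} (ho : IsOpen s)
    (hs : _root_.IsPreconnected s)
    (h : EqOn c c' s) {t₀ t₁ : ℝ} (h₀ : t₀ ∈ s) (h₁ : t₁ ∈ s) :
    A.transport c hc t₁ * (A.transport c hc t₀)⁻¹ =
      A.transport c' hc' t₁ * (A.transport c' hc' t₀)⁻¹ := by
  have : IsTopologicalGroup G := topologicalGroup_of_lieGroup 𝓘(ℝ, E') ∞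
  refine eqOn_of_hasRightLogDerivAt (a := A.velocity c') ho hs
    (g := fun t => A.transport c hc t * (A.transport c hc t₀)⁻¹)
    (k := fun t => A.transport c' hc' t * (A.transport c' hc' t₀)⁻¹)
    (fun t ht => ?_) (fun t _ => (A.hasRightLogDerivAt_transport hc' t).mul_const _) h₀
    (by simp) h₁
  rw [velocity, ← A.pullback_congr (h.eventuallyEq_of_mem (ho.mem_nhds ht))]
  exact (A.hasRightLogDerivAt_transport hc t).mul_const _

omit [FiniteDimensional ℝ E] in
lemma transport_trans {x y z : M} (γ : LazyPath 𝓘(ℝ, E) x y) (δ : LazyPath 𝓘(ℝ, E) y z) :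
    A.transport (γ.trans δ) (γ.trans δ).smooth 1 =
      A.transport δ δ.smooth 1 * A.transport γ γ.smooth 1 := by
  obtain ⟨ε, hε, -, h1⟩ := γ.lazy
  obtain ⟨ε', hε', h0', -⟩ := δ.lazy
  -- Thanks to the sitting instants each half of the concatenation is given by its formula on an
  -- open half-line reaching past 1/2, so the local comparison applies up to and including 1/2.
  have e1 : EqOn (γ.trans δ) (fun t => γ (2 * t)) (Iio ((1 + ε') / 2)) := by
    intro t ht
    rw [mem_Iio] at ht
    simp only [LazyPath.trans]
    split_ifs with h
    · rfl
    · rw [h0' _ (by linarith), h1 _ (by linarith)]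
  have e2 : EqOn (γ.trans δ) (fun t => δ (2 * t - 1)) (Ioi ((1 - ε) / 2)) := by
    intro t ht
    rw [mem_Ioi] at ht
    simp only [LazyPath.trans]
    split_ifs with h
    · rw [h0' _ (by linarith), h1 _ (by linarith)]
    · rfl
  have h2 : ContDiff ℝ ∞ (fun t : ℝ => 2 * t) := contDiff_const.mul contDiff_id
  have h21 : ContDiff ℝ ∞ (fun t : ℝ => 2 * t - 1) := h2.sub contDiff_const
  have k1 := A.transport_mul_inv_of_eqOn (γ.trans δ).smooth (c' := fun t => γ (2 * t))
    (γ.smooth.comp h2.contMDiff) isOpen_Iio isPreconnected_Iio e1 (t₀ := 0) (t₁ := 1 / 2)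
    (by rw [mem_Iio]; linarith) (by rw [mem_Iio]; linarith)
  have k2 := A.transport_mul_inv_of_eqOn (γ.trans δ).smooth (c' := fun t => δ (2 * t - 1))
    (δ.smooth.comp h21.contMDiff) isOpen_Ioi isPreconnected_Ioi e2 (t₀ := 1 / 2) (t₁ := 1)
    (by rw [mem_Ioi]; linarith) (by rw [mem_Ioi]; linarith)
  rw [A.transport_comp γ.smooth h2, A.transport_comp γ.smooth h2, transport_zero] at k1
  rw [A.transport_comp δ.smooth h21, A.transport_comp δ.smooth h21] at k2
  norm_num [transport_zero] at k1 k2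
  rw [← k1, ← k2]
  group

/-- The functor from the path groupoid to `G` that sends a path to the parallel transport
along it. -/
def holonomyFunctor : PathGroupoid 𝓘(ℝ, E) M ⥤ SingleObj G where
  obj _ := SingleObj.star G
  map {x y} f := Quotient.lift (s := thinSetoid 𝓘(ℝ, E) x.as y.as)
    (fun γ : LazyPath 𝓘(ℝ, E) x.as y.as => A.transport γ γ.smooth 1)
    (fun _ _ h => A.transport_eq_of_thinHomotopic h) f
  map_id x := A.transport_const x.as 1
  map_comp f g := Quotient.inductionOn₂ f g fun γ δ => A.transport_trans γ δ

lemma holonomy_holonomyFunctor {x y : M} (γ : LazyPath 𝓘(ℝ, E) x y) :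
    holonomy A.holonomyFunctor γ = A.transport γ γ.smooth 1 := rfl

/-- The family lives only over U, while smooth dependence was shown for globally defined families; a
smooth map into U that is the identity near u bridges the two. -/
lemma isSmoothFunctor_holonomyFunctor : IsSmoothFunctor 𝓘(ℝ, E') A.holonomyFunctor := by
  intro k U hU x y c hc u hu
  obtain ⟨ρ, hρ, hρid, hρU⟩ := exists_contDiff_eventuallyEq_id (hU.mem_nhds hu)
  have h1 : ContMDiff 𝓘(ℝ, EuclideanSpace ℝ (Fin k) × ℝ) 𝓘(ℝ, E) ∞
      (fun p : EuclideanSpace ℝ (Fin k) × ℝ => c (ρ p.1) p.2) := by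
    rw [← contMDiffOn_univ]
    exact ContMDiffOn.comp (g := fun p : EuclideanSpace ℝ (Fin k) × ℝ => c p.1 p.2)
      (f := fun p : EuclideanSpace ℝ (Fin k) × ℝ => (ρ p.1, p.2)) hc
      ((hρ.comp contDiff_fst).prodMk contDiff_snd).contMDiff.contMDiffOn
      fun p _ => ⟨hρU _, mem_univ _⟩
  have h2 := (A.contMDiff_transport h1).comp
    (contDiff_id.prodMk (contDiff_const (c := (1 : ℝ)))).contMDiff
  refine ContMDiffAt.contMDiffWithinAt ((h2 u).congr_of_eventuallyEq ?_)
  filter_upwards [hρid] with w hw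
  have h3 : ρ w = w := hw
  rw [holonomy_holonomyFunctor]
  exact congrFun (A.transport_congr (c w).smooth (c (ρ w)).smooth fun t => by rw [h3]) 1

end TrivialBundleConnection

end HolonomyFunctor
end

noncomputable section

/-! ### From a smooth functor to its connection. -/

section FunctorConnection

open Set Filter Topology CategoryTheory

universe u v

section Holonomy

variable {E : Type*} [NormedAddCommGroup E] [NormedSpace ℝ E]
  {H : Type*} [TopologicalSpace H] {I : ModelWithCorners ℝ E H}
  {M : Type*} [TopologicalSpace M] [ChartedSpace H M] {G : Type*} [Group G]
  (F : PathGroupoid I M ⥤ SingleObj G)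

/-! ### Holonomy of paths -/

lemma holonomy_refl (x : M) : holonomy F (LazyPath.refl I x) = 1 := F.map_id ⟨x⟩

lemma holonomy_trans {x y z : M} (γ : LazyPath I x y) (δ : LazyPath I y z) :
    holonomy F (γ.trans δ) = holonomy F δ * holonomy F γ := F.map_comp γ.toHom δ.toHom

lemma holonomy_eq_of_thinHomotopic {x y : M} {γ δ : LazyPath I x y} (h : ThinHomotopic I γ δ) :
    holonomy F γ = holonomy F δ :=
  congrArg (fun f : (⟨x⟩ : PathGroupoid I M) ⟶ ⟨y⟩ => F.map f)
    (Quotient.sound (s := thinSetoid I x y) h)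

lemma LazyPath.apply_zero {x y : M} (γ : LazyPath I x y) : γ 0 = x := by
  obtain ⟨ε, hε, h0, -⟩ := γ.lazy
  exact h0 0 hε.le

lemma LazyPath.apply_one {x y : M} (γ : LazyPath I x y) : γ 1 = y := by
  obtain ⟨ε, hε, -, h1⟩ := γ.lazy
  exact h1 1 (by linarith)

/-- The end points are values of the map, so paths with the same underlying map have the same
holonomy even when their types name different end points. -/
lemma holonomy_congr {x y x' y' : M} {γ : LazyPath I x y} {δ : LazyPath I x' y'}
    (h : ∀ t, γ t = δ t) : holonomy F γ = holonomy F δ := by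
  obtain rfl : x = x' := by rw [← γ.apply_zero, ← δ.apply_zero, h]
  obtain rfl : y = y' := by rw [← γ.apply_one, ← δ.apply_one, h]
  obtain ⟨γ, hγ, hγ'⟩ := γ
  obtain ⟨δ, hδ, hδ'⟩ := δ
  obtain rfl : γ = δ := funext h
  rfl

lemma holonomy_eq_one {x y z : M} {γ : LazyPath I x y} (h : ∀ t, γ t = z) : holonomy F γ = 1 :=
  (holonomy_congr F (δ := LazyPath.refl I z) h).trans (holonomy_refl F z)

/-- The holonomy of a functor along the curves of a family, over the unit interval. -/
def familyHolonomy {V : Type*} [NormedAddCommGroup V] [NormedSpace ℝ V] (c : V × ℝ → M)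
    (hc : ContMDiff 𝓘(ℝ, V × ℝ) I ∞ c) (w : V) : G :=
  holonomy F (LazyPath.ofCurve (fun t => c (w, t))
    (hc.comp (contDiff_const.prodMk contDiff_id).contMDiff) 1)

variable {E' : Type*} [NormedAddCommGroup E'] [NormedSpace ℝ E'] {H' : Type*} [TopologicalSpace H']
  {J : ModelWithCorners ℝ E' H'} [TopologicalSpace G] [ChartedSpace H' G]

variable {F} in
-- A linear isomorphism with a Euclidean space frees the parameter space from the form prescribed in
-- the definition of smoothness.
lemma IsSmoothFunctor.contMDiff_familyHolonomy (hF : IsSmoothFunctor J F) {V : Type*}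
    [NormedAddCommGroup V] [NormedSpace ℝ V] [FiniteDimensional ℝ V] {c : V × ℝ → M}
    (hc : ContMDiff 𝓘(ℝ, V × ℝ) I ∞ c) : ContMDiff 𝓘(ℝ, V) J ∞ (familyHolonomy F c hc) := by
  let e : V ≃L[ℝ] EuclideanSpace ℝ (Fin (Module.finrank ℝ V)) := toEuclidean
  have hce : ContMDiff 𝓘(ℝ, EuclideanSpace ℝ (Fin (Module.finrank ℝ V)) × ℝ) I ∞
      (fun p : EuclideanSpace ℝ (Fin (Module.finrank ℝ V)) × ℝ => c (e.symm p.1, p.2)) :=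
    hc.comp ((e.symm.contDiff.comp contDiff_fst).prodMk contDiff_snd).contMDiff
  have h := hF _ univ isOpen_univ _ _ (fun w => LazyPath.ofCurve (fun t => c (e.symm w, t))
    (hce.comp (contDiff_const.prodMk contDiff_id).contMDiff) 1) (ContMDiff.contMDiffOn
      (hce.comp (contDiff_fst.prodMk
        (contDiff_const.mul (smoothStep_contDiff.comp contDiff_snd))).contMDiff))
  rw [contMDiffOn_univ] at h
  refine (h.comp e.contDiff.contMDiff).congr fun w => holonomy_congr F fun t => ?_
  simp [LazyPath.ofCurve]

end Holonomy

/-! ### The infinitesimal holonomy -/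

variable {E : Type u} [NormedAddCommGroup E] [NormedSpace ℝ E] [FiniteDimensional ℝ E]
  {M : Type*} [TopologicalSpace M] [ChartedSpace E M]
  {E' : Type v} [NormedAddCommGroup E'] [NormedSpace ℝ E']
  {G : Type*} [TopologicalSpace G] [ChartedSpace E' G] [Group G] [LieGroup 𝓘(ℝ, E') ∞ G]
  {F : PathGroupoid 𝓘(ℝ, E) M ⥤ SingleObj G} (hF : IsSmoothFunctor 𝓘(ℝ, E') F)

omit [FiniteDimensional ℝ E] in
lemma contMDiff_segments {ψ : E → M} (hψ : ContMDiff 𝓘(ℝ, E) 𝓘(ℝ, E) ∞ ψ) :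
    ContMDiff 𝓘(ℝ, (E × E) × ℝ) 𝓘(ℝ, E) ∞
      (fun p : (E × E) × ℝ => ψ (p.1.1 + p.2 • p.1.2)) :=
  hψ.comp (ContDiff.contMDiff (by fun_prop))

variable (F) in
/-- The derivative of the holonomy along short segments in a parametrization of `M`. -/
def infinitesimalHolonomy (ψ : E → M) (hψ : ContMDiff 𝓘(ℝ, E) 𝓘(ℝ, E) ∞ ψ) (z : E) : E →L[ℝ] E' :=
  fderiv ℝ (fun w => chartOne E' G (familyHolonomy F _ (contMDiff_segments hψ) (z, w))) 0

include hF

lemma contDiffAt_chartOne_segments {ψ : E → M} (hψ : ContMDiff 𝓘(ℝ, E) 𝓘(ℝ, E) ∞ ψ) (z : E) :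
    ContDiffAt ℝ ∞ (fun p => chartOne E' G (familyHolonomy F _ (contMDiff_segments hψ) p))
      (z, 0) := by
  refine ContMDiffAt.contDiffAt (ContMDiffAt.comp (g := chartOne E' G) _
    (contMDiffAt_chartOne ?_) (hF.contMDiff_familyHolonomy (contMDiff_segments hψ)).contMDiffAt)
  rw [familyHolonomy, holonomy_eq_one F (z := ψ z) (fun t => by simp [LazyPath.ofCurve])]
  exact one_mem_chartOne_source

lemma contDiff_infinitesimalHolonomy {ψ : E → M} (hψ : ContMDiff 𝓘(ℝ, E) 𝓘(ℝ, E) ∞ ψ) :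
    ContDiff ℝ ∞ (infinitesimalHolonomy (E' := E') F ψ hψ) := by
  refine contDiff_iff_contDiffAt.2 fun z => ?_
  exact ContDiffAt.fderiv (n := ∞) (f := fun z w => chartOne E' G
    (familyHolonomy F _ (contMDiff_segments hψ) (z, w))) (g := fun _ => (0 : E))
    (contDiffAt_chartOne_segments hF hψ z) contDiffAt_const (by simp)

/-- The holonomy along the initial pieces of a curve, to first order. -/
lemma hasRightLogDerivAt_holonomy_ofCurve {ψ : E → M} (hψ : ContMDiff 𝓘(ℝ, E) 𝓘(ℝ, E) ∞ ψ)
    {c : ℝ → M} (hc : ContMDiff 𝓘(ℝ, ℝ) 𝓘(ℝ, E) ∞ c) {k : ℝ → E}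
    (hk : ∀ᶠ s in 𝓝 0, ContDiffAt ℝ ∞ k s)
    (hck : ∀ᶠ s in 𝓝 0, c s = ψ (k s)) :
    HasRightLogDerivAt (fun s => (holonomy F (LazyPath.ofCurve c hc s) : G))
      (infinitesimalHolonomy (E' := E') F ψ hψ (k 0) (deriv k 0)) 0 := by
  obtain ⟨ρ, hρ, hρid, hρU⟩ := exists_contDiff_eventuallyEq_id hk
  have hkρ : ContDiff ℝ ∞ (k ∘ ρ) :=
    contDiff_iff_contDiffAt.2 fun s => ContDiffAt.comp s (g := k) (hρU s) hρ.contDiffAt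
  obtain ⟨w, hw, hw0, hkw⟩ := exists_contDiff_eq_add_smul hkρ
  have hkk : k ∘ ρ =ᶠ[𝓝 0] k := hρid.fun_comp k
  rw [hkk.deriv_eq] at hw0
  rw [hkk.eq_of_nhds] at hkw
  -- By Hadamard k(s) = k(0) + s w(s) near 0. The parameters (r, s) give the curve t ↦ ψ(k(0) + rt
  -- w(st)): for r = 0 it is constant, for s = 0 the image of a segment in direction k'(0), and for
  -- small r = s it is t ↦ c(st). The diagonal derivative at (0, 0) is therefore the r-derivative
  -- along segments.
  have hH : ContMDiff 𝓘(ℝ, (ℝ × ℝ) × ℝ) 𝓘(ℝ, E) ∞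
      (fun p : (ℝ × ℝ) × ℝ => ψ (k 0 + (p.1.1 * p.2) • w (p.1.2 * p.2))) :=
    hψ.comp (ContDiff.contMDiff (by fun_prop))
  let h : ℝ × ℝ → G := familyHolonomy F _ hH
  have hh : ContMDiff 𝓘(ℝ, ℝ × ℝ) 𝓘(ℝ, E') ∞ h := hF.contMDiff_familyHolonomy hH
  have h0 : ∀ s, h (0, s) = 1 := fun s =>
    holonomy_eq_one F (z := ψ (k 0)) fun t => by simp [LazyPath.ofCurve]
  have hdiag : ∀ᶠ s in 𝓝 0, holonomy F (LazyPath.ofCurve c hc s) = h (s, s) := by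
    obtain ⟨r, hr, hball⟩ := Metric.eventually_nhds_iff.1 (hck.and hkk)
    refine Metric.eventually_nhds_iff.2 ⟨r, hr, fun s hs => holonomy_congr F fun t => ?_⟩
    rw [dist_zero_right, Real.norm_eq_abs] at hs
    have hst : dist (s * smoothStep t) 0 < r := by
      rw [dist_zero_right, Real.norm_eq_abs, abs_mul, abs_of_nonneg (smoothStep_nonneg t)]
      exact (mul_le_of_le_one_right (abs_nonneg s) (smoothStep_le_one t)).trans_lt hs
    simp only [LazyPath.ofCurve, one_mul]
    rw [(hball hst).1, ← (hball hst).2, hkw]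
  have hf : ContDiffAt ℝ ∞ (fun p => chartOne E' G (h p)) (0, 0) := by
    refine ContMDiffAt.contDiffAt (ContMDiffAt.comp (g := chartOne E' G) _
      (contMDiffAt_chartOne ?_) hh.contMDiffAt)
    rw [h0]
    exact one_mem_chartOne_source
  have hfd := hf.differentiableAt (by simp)
  have e2 : fderiv ℝ (fun p => chartOne E' G (h p)) (0, 0) (0, 1) = 0 := by
    refine (hasDerivAt_slice_right hfd).unique ?_
    simp only [h0]
    exact hasDerivAt_const _ _
  have e1 : fderiv ℝ (fun p => chartOne E' G (h p)) (0, 0) (1, 0) =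
      infinitesimalHolonomy (E' := E') F ψ hψ (k 0) (deriv k 0) := by
    refine (hasDerivAt_slice_left hfd).unique ?_
    have h1 : HasFDerivAt (fun w => chartOne E' G
        (familyHolonomy F _ (contMDiff_segments hψ) (k 0, w)))
        (infinitesimalHolonomy (E' := E') F ψ hψ (k 0)) ((0 : ℝ) • deriv k 0) := by
      rw [zero_smul]
      exact (((contDiffAt_chartOne_segments hF hψ (k 0)).comp (0 : E)
        (contDiffAt_const.prodMk contDiffAt_id)).differentiableAt (by simp)).hasFDerivAt
    have h2 := h1.comp_hasDerivAt (0 : ℝ) ((hasDerivAt_id (0 : ℝ)).smul_const (deriv k 0))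
    rw [one_smul] at h2
    refine h2.congr_of_eventuallyEq (Eventually.of_forall fun r => ?_)
    refine congrArg (chartOne E' G) (holonomy_congr F fun t => ?_)
    simp [LazyPath.ofCurve, hw0, smul_smul, mul_comm]
  have hd : HasDerivAt (fun s : ℝ => chartOne E' G (h (s, s)))
      (infinitesimalHolonomy (E' := E') F ψ hψ (k 0) (deriv k 0)) 0 := by
    have h3 := HasFDerivAt.comp_hasDerivAt (l := fun p => chartOne E' G (h p))
      (f := fun s : ℝ => (s, s)) 0 hfd.hasFDerivAt
      ((hasDerivAt_id (0 : ℝ)).prodMk (hasDerivAt_id 0))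
    have h4 : ((1, 1) : ℝ × ℝ) = (1, 0) + (0, 1) := by simp
    rwa [h4, map_add, e1, e2, add_zero] at h3
  refine HasRightLogDerivAt.congr (g := fun s => h (s, s)) ⟨?_, ?_⟩ hdiag
  · exact (hh.continuous.comp (continuous_id.prodMk continuous_id)).continuousAt
  · simpa [h0] using hd

/-! ### The connection of a smooth functor -/

section Connection

variable [IsManifold 𝓘(ℝ, E) ∞ M]

omit hF in
-- Push a straight line in the chart forward by a global parametrization. Identities between forms
-- can then be tested on globally defined curves.
lemma exists_curve_tangentMap_eq (p : TangentBundle 𝓘(ℝ, E) M) : ∃ c : ℝ → M,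
    ContMDiff 𝓘(ℝ, ℝ) 𝓘(ℝ, E) ∞ c ∧ tangentMap 𝓘(ℝ, ℝ) 𝓘(ℝ, E) c ⟨0, (1 : ℝ)⟩ = p := by
  obtain ⟨ψ, hψ, hψφ, -⟩ := exists_contMDiff_localInverse (E := E) p.proj
  let φ := extChartAt 𝓘(ℝ, E) p.proj
  let q : TangentBundle 𝓘(ℝ, E) E := tangentMap 𝓘(ℝ, E) 𝓘(ℝ, E) φ p
  let u : E := q.2
  have hℓ : HasDerivAt (fun s : ℝ => φ p.proj + s • u) u 0 := by
    simpa using ((hasDerivAt_id (0 : ℝ)).smul_const u).const_add (φ p.proj)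
  refine ⟨fun s => ψ (φ p.proj + s • u), hψ.comp (ContDiff.contMDiff (by fun_prop)), ?_⟩
  have h1 : tangentMap 𝓘(ℝ, ℝ) 𝓘(ℝ, E) (fun s : ℝ => φ p.proj + s • u) ⟨0, (1 : ℝ)⟩ = q := by
    refine Bundle.TotalSpace.ext (by simp [q]) (heq_of_eq ?_)
    change mfderiv 𝓘(ℝ, ℝ) 𝓘(ℝ, E) (fun s : ℝ => φ p.proj + s • u) 0 (1 : ℝ) = u
    have h5 : fderiv ℝ (fun s : ℝ => φ p.proj + s • u) 0 1 = u := by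
      rw [fderiv_apply_one_eq_deriv, hℓ.deriv]
    rw [mfderiv_eq_fderiv]
    exact h5
  have h2 : tangentMap 𝓘(ℝ, ℝ) 𝓘(ℝ, E) (ψ ∘ fun s : ℝ => φ p.proj + s • u) ⟨0, (1 : ℝ)⟩ =
      tangentMap 𝓘(ℝ, E) 𝓘(ℝ, E) ψ q := by
    rw [tangentMap_comp_at _ (hψ.mdifferentiableAt (by simp)) hℓ.differentiableAt.mdifferentiableAt,
      h1]
  refine h2.trans ?_
  rw [← tangentMap_comp_at p (hψ.mdifferentiableAt (by simp))
    ((contMDiffAt_extChartAt (n := ∞)).mdifferentiableAt (by simp))]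
  refine Bundle.TotalSpace.ext hψφ.self_of_nhds (heq_of_eq ?_)
  have h3 : mfderiv 𝓘(ℝ, E) 𝓘(ℝ, E) (ψ ∘ φ) p.proj = _ :=
    Filter.EventuallyEq.mfderiv_eq (f := id) hψφ
  change mfderiv 𝓘(ℝ, E) 𝓘(ℝ, E) (ψ ∘ φ) p.proj p.snd = p.snd
  rw [h3, mfderiv_id]
  rfl

/-- The chart need not be centred at c 0; this freedom allows one chart to serve all nearby base
points. -/
lemma hasRightLogDerivAt_holonomy_chart {x : M} {ψ : E → M}
    (hψ : ContMDiff 𝓘(ℝ, E) 𝓘(ℝ, E) ∞ ψ) {c : ℝ → M} (hc : ContMDiff 𝓘(ℝ, ℝ) 𝓘(ℝ, E) ∞ c)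
    (hx : c 0 ∈ (chartAt E x).source) (hψφ : ∀ᶠ y in 𝓝 (c 0), ψ (extChartAt 𝓘(ℝ, E) x y) = y) :
    HasRightLogDerivAt (fun s => (holonomy F (LazyPath.ofCurve c hc s) : G))
      (infinitesimalHolonomy (E' := E') F ψ hψ (extChartAt 𝓘(ℝ, E) x (c 0))
        (mfderiv 𝓘(ℝ, E) 𝓘(ℝ, E) (extChartAt 𝓘(ℝ, E) x) (c 0)
          (mfderiv 𝓘(ℝ, ℝ) 𝓘(ℝ, E) c 0 (1 : ℝ)))) 0 := by
  have h1 : ∀ᶠ s in 𝓝 0, c s ∈ (chartAt E x).source :=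
    hc.continuous.continuousAt.preimage_mem_nhds ((chartAt E x).open_source.mem_nhds hx)
  have h := hasRightLogDerivAt_holonomy_ofCurve hF hψ hc (k := fun s => extChartAt 𝓘(ℝ, E) x (c s))
    (h1.mono fun s hs => ((contMDiffAt_extChartAt' hs).comp s hc.contMDiffAt).contDiffAt)
    ((hc.continuous.continuousAt.eventually hψφ).mono fun s hs => hs.symm)
  convert h using 2
  rw [← fderiv_apply_one_eq_deriv, ← mfderiv_eq_fderiv]
  have h2 : mfderiv 𝓘(ℝ, ℝ) 𝓘(ℝ, E) (extChartAt 𝓘(ℝ, E) x ∘ c) 0 = _ :=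
    mfderiv_comp 0 ((contMDiffAt_extChartAt' (n := ∞) hx).mdifferentiableAt (by simp))
      (hc.mdifferentiableAt (by simp))
  exact congrArg (fun L : ℝ →L[ℝ] E => infinitesimalHolonomy (E' := E') F ψ hψ
    (extChartAt 𝓘(ℝ, E) x (c 0)) (L 1)) h2.symm

omit hF in
variable (F) in
/-- The 1-form of a functor: the derivative of the holonomy along short curves. -/
def holonomyForm (x : M) : TangentSpace 𝓘(ℝ, E) x →L[ℝ] GroupLieAlgebra 𝓘(ℝ, E') G :=
  ContinuousLinearMap.comp (M₂ := E) (M₃ := E')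
    (infinitesimalHolonomy (E' := E') F _ (exists_contMDiff_localInverse x).choose_spec.1
      (extChartAt 𝓘(ℝ, E) x x)) (mfderiv 𝓘(ℝ, E) 𝓘(ℝ, E) (extChartAt 𝓘(ℝ, E) x) x)

lemma hasRightLogDerivAt_holonomyForm {c : ℝ → M} (hc : ContMDiff 𝓘(ℝ, ℝ) 𝓘(ℝ, E) ∞ c) :
    HasRightLogDerivAt (E' := E') (fun s => (holonomy F (LazyPath.ofCurve c hc s) : G))
      (holonomyForm (E' := E') F (c 0) (mfderiv 𝓘(ℝ, ℝ) 𝓘(ℝ, E) c 0 (1 : ℝ))) 0 :=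
  hasRightLogDerivAt_holonomy_chart hF (exists_contMDiff_localInverse (c 0)).choose_spec.1 hc
    (mem_chart_source E (c 0)) (exists_contMDiff_localInverse (c 0)).choose_spec.2.1

/-- The form is defined with a different chart at each point. Near p₀ it agrees with the expression
in the one chart at the base point of p₀, since both are the logarithmic derivative of the same
holonomy curve; that expression is visibly smooth. -/
lemma contMDiff_holonomyForm : ContMDiff (M' := E') 𝓘(ℝ, E).tangent 𝓘(ℝ, E') ∞
    (fun p : TangentBundle 𝓘(ℝ, E) M => holonomyForm (E' := E') F p.proj p.snd) := by
  intro p₀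
  let x := p₀.proj
  obtain ⟨ψ, hψ, hψφ, -⟩ := exists_contMDiff_localInverse (E := E) x
  have hsrc : ∀ᶠ y in 𝓝 x, y ∈ (chartAt E x).source := chart_source_mem_nhds E x
  have hT := (Bundle.contMDiffAt_totalSpace (n := ∞) (F := E) (E := TangentSpace 𝓘(ℝ, E) (M := M))
    (IM := 𝓘(ℝ, E).tangent) (IB := 𝓘(ℝ, E)) (x₀ := p₀)).1 contMDiffAt_id
  have h1 : ContMDiffAt 𝓘(ℝ, E).tangent 𝓘(ℝ, E →L[ℝ] E') ∞ (fun p : TangentBundle 𝓘(ℝ, E) M =>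
      infinitesimalHolonomy (E' := E') F ψ hψ (extChartAt 𝓘(ℝ, E) x p.proj)) p₀ :=
    ((contDiff_infinitesimalHolonomy hF hψ).contMDiff.contMDiffAt).comp p₀
      ((contMDiffAt_extChartAt (x := x)).comp p₀ hT.1)
  refine (h1.clm_apply hT.2).congr_of_eventuallyEq ?_
  -- The parametrization ψ must invert the chart on a whole neighbourhood of the nearby base point,
  -- not just there, hence `eventually_nhds`.
  filter_upwards [(FiberBundle.continuous_proj E (TangentSpace 𝓘(ℝ, E))).continuousAt.eventually
    (hψφ.eventually_nhds.and hsrc)] with p hp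
  obtain ⟨c, hc, rfl⟩ := exists_curve_tangentMap_eq p
  have h2 := (hasRightLogDerivAt_holonomyForm hF hc).unique
    (hasRightLogDerivAt_holonomy_chart hF hψ (x := x) hc hp.2 hp.1)
  refine h2.trans (congrArg (infinitesimalHolonomy (E' := E') F ψ hψ
    (extChartAt 𝓘(ℝ, E) x (c 0))) ?_)
  have hx : c 0 ∈ (chartAt E x).source := hp.2
  have h3 := TangentBundle.continuousLinearMapAt_trivializationAt (I := 𝓘(ℝ, E)) hx
  exact (congrArg (fun L : E →L[ℝ] E => L (mfderiv 𝓘(ℝ, ℝ) 𝓘(ℝ, E) c 0 (1 : ℝ))) h3).symm.trans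
    (Bundle.Trivialization.continuousLinearMapAt_apply_of_mem ℝ _ (by simpa using hx) _)

variable (F) in
/-- The connection of a smooth functor. -/
def holonomyConnection : TrivialBundleConnection 𝓘(ℝ, E) M 𝓘(ℝ, E') G where
  form := holonomyForm F
  smooth := contMDiff_holonomyForm hF

end Connection

end FunctorConnection
end

noncomputable section

/-! ### The two constructions are mutually inverse. -/

section Correspondence

open Set Filter Topology CategoryTheory

universe u v

variable {E : Type u} [NormedAddCommGroup E] [NormedSpace ℝ E] [FiniteDimensional ℝ E]
  {M : Type*} [TopologicalSpace M] [ChartedSpace E M] [IsManifold 𝓘(ℝ, E) ∞ M]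
  {E' : Type v} [NormedAddCommGroup E'] [NormedSpace ℝ E']
  {G : Type*} [TopologicalSpace G] [ChartedSpace E' G] [Group G] [LieGroup 𝓘(ℝ, E') ∞ G]

/-! ### From connections to functors and back -/

lemma TrivialBundleConnection.holonomy_ofCurve [FiniteDimensional ℝ E']
    (A : TrivialBundleConnection 𝓘(ℝ, E) M 𝓘(ℝ, E') G)
    {c : ℝ → M} (hc : ContMDiff 𝓘(ℝ, ℝ) 𝓘(ℝ, E) ∞ c) (s : ℝ) :
    holonomy A.holonomyFunctor (LazyPath.ofCurve c hc s) = A.transport c hc s := by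
  have h := A.transport_comp hc (φ := fun t => s * smoothStep t)
    (contDiff_const.mul smoothStep_contDiff) 1
  rw [smoothStep_of_le (t := 0) (by norm_num), smoothStep_of_ge (t := 1) (by norm_num),
    mul_zero, mul_one, A.transport_zero, inv_one, mul_one] at h
  exact h

/-- Along a curve realizing a given tangent vector, both forms are the logarithmic derivative at 0
of the same curve s ↦ transport of A up to s. -/
lemma holonomyConnection_holonomyFunctor [FiniteDimensional ℝ E']
    (A : TrivialBundleConnection 𝓘(ℝ, E) M 𝓘(ℝ, E') G) :
    holonomyConnection A.holonomyFunctor A.isSmoothFunctor_holonomyFunctor = A := by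
  refine TrivialBundleConnection.ext (funext fun x => ContinuousLinearMap.ext fun w => ?_)
  have key : ∀ p : TangentBundle 𝓘(ℝ, E) M,
      (holonomyForm (E' := E') A.holonomyFunctor p.proj p.snd : E') = A.form p.proj p.snd := by
    intro p
    obtain ⟨c, hc, rfl⟩ := exists_curve_tangentMap_eq p
    refine (hasRightLogDerivAt_holonomyForm A.isSmoothFunctor_holonomyFunctor hc).unique
      ((A.hasRightLogDerivAt_transport hc 0).congr (Eventually.of_forall fun s => ?_))
    exact A.holonomy_ofCurve hc s
  exact key ⟨x, w⟩

/-! ### From functors to connections and back -/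

variable (F : PathGroupoid 𝓘(ℝ, E) M ⥤ SingleObj G)

/-- The piece of a curve between two parameters. -/
def LazyPath.piece {c : ℝ → M} (hc : ContMDiff 𝓘(ℝ, ℝ) 𝓘(ℝ, E) ∞ c) (s r : ℝ) :
    LazyPath 𝓘(ℝ, E) (c s) (c r) where
  toFun t := c (s + (r - s) * smoothStep t)
  smooth := hc.comp (contDiff_const.add (contDiff_const.mul smoothStep_contDiff)).contMDiff
  lazy := ⟨1 / 3, by norm_num, fun t ht => by rw [smoothStep_of_le ht, mul_zero, add_zero],
    fun t ht => by rw [smoothStep_of_ge (by linarith), mul_one, add_sub_cancel]⟩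

-- Both the direct piece and the concatenation factor through c, and interpolating their time
-- functions linearly gives a homotopy through c, which is thin.
omit [FiniteDimensional ℝ E] [IsManifold 𝓘(ℝ, E) ∞ M] [TopologicalSpace G] in
lemma holonomy_ofCurve_eq_mul {c : ℝ → M} (hc : ContMDiff 𝓘(ℝ, ℝ) 𝓘(ℝ, E) ∞ c) (s r : ℝ) :
    holonomy F (LazyPath.ofCurve c hc r) =
      holonomy F (LazyPath.piece hc s r) * holonomy F (LazyPath.ofCurve c hc s) := by
  rw [← holonomy_trans]
  have hσ := smoothStep_contDiff
  refine holonomy_eq_of_thinHomotopic F (LazyPath.thin_of_factor hc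
    (φ := fun t => r * smoothStep t)
    (ψ := fun t => s * smoothStep (2 * t) + (r - s) * smoothStep (2 * t - 1))
    (contDiff_const.mul hσ) ?_ (fun t => rfl) (fun t => ?_) (show (0 : ℝ) < 1 / 6 by norm_num)
    (fun t ht q _ _ => ?_) (fun t ht q _ _ => ?_))
  · exact (contDiff_const.mul (hσ.comp (contDiff_const.mul contDiff_id))).add
      (contDiff_const.mul (hσ.comp ((contDiff_const.mul contDiff_id).sub contDiff_const)))
  · rcases le_or_gt t (1 / 2) with ht | ht
    · simp only [LazyPath.trans, LazyPath.ofCurve, ht, if_true,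
        smoothStep_of_le (show 2 * t - 1 ≤ 1 / 3 by linarith), mul_zero, add_zero]
    · simp only [LazyPath.trans, LazyPath.piece, not_le.2 ht, if_false,
        smoothStep_of_ge (show 2 / 3 ≤ 2 * t by linarith), mul_one]
  · rw [smoothStep_of_le (show t ≤ 1 / 3 by linarith),
      smoothStep_of_le (show 2 * t ≤ 1 / 3 by linarith),
      smoothStep_of_le (show 2 * t - 1 ≤ 1 / 3 by linarith)]
    simp
  · rw [smoothStep_of_ge (show 2 / 3 ≤ t by linarith),
      smoothStep_of_ge (show 2 / 3 ≤ 2 * t by linarith),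
      smoothStep_of_ge (show 2 / 3 ≤ 2 * t - 1 by linarith)]
    congr 1
    ring

variable {F} (hF : IsSmoothFunctor 𝓘(ℝ, E') F)

/-- Functoriality splits off the holonomy up to s as a constant right factor, so the derivative at s
is the derivative at 0 for the curve shifted by s. -/
lemma hasRightLogDerivAt_holonomy {c : ℝ → M} (hc : ContMDiff 𝓘(ℝ, ℝ) 𝓘(ℝ, E) ∞ c) (s : ℝ) :
    HasRightLogDerivAt (fun r => (holonomy F (LazyPath.ofCurve c hc r) : G))
      ((holonomyConnection F hF).velocity c s) s := by
  have : IsTopologicalGroup G := topologicalGroup_of_lieGroup 𝓘(ℝ, E') ∞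
  have hcs : ContMDiff 𝓘(ℝ, ℝ) 𝓘(ℝ, E) ∞ (fun r => c (s + r)) :=
    hc.comp (contDiff_const.add contDiff_id).contMDiff
  have h1 : HasDerivAt (fun r : ℝ => s + r) 1 0 := (hasDerivAt_id (0 : ℝ)).const_add s
  have h2 : HasDerivAt (fun r : ℝ => r - s) 1 s := (hasDerivAt_id s).sub_const s
  have hv : (holonomyConnection F hF).velocity (fun r => c (s + r)) 0 =
      (holonomyConnection F hF).velocity c s := by
    rw [TrivialBundleConnection.velocity_comp _ hc h1, one_smul, add_zero]
  have h3 : HasRightLogDerivAt (fun r => (holonomy F (LazyPath.ofCurve _ hcs r) : G))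
      ((holonomyConnection F hF).velocity c s) (s - s) := by
    rw [← hv, sub_self]
    exact hasRightLogDerivAt_holonomyForm hF hcs
  have h4 := (HasRightLogDerivAt.scomp (φ := fun r => r - s) h3 h2).mul_const
    (holonomy F (LazyPath.ofCurve c hc s))
  rw [one_smul] at h4
  refine h4.congr (Eventually.of_forall fun r => ?_)
  exact (holonomy_ofCurve_eq_mul F hc s r).trans
    (congrArg (· * _) (holonomy_congr F fun t => rfl))

lemma holonomy_eq_transport [FiniteDimensional ℝ E'] {x y : M} (γ : LazyPath 𝓘(ℝ, E) x y) :
    holonomy F γ = (holonomyConnection F hF).transport γ γ.smooth 1 := by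
  rw [← (holonomyConnection F hF).eq_transport γ.smooth
    (g := fun s => holonomy F (LazyPath.ofCurve γ γ.smooth s)) ?_
    (hasRightLogDerivAt_holonomy hF γ.smooth)]
  -- The piece of γ up to parameter 1 is γ run through the smooth step, which is thinly homotopic to
  -- γ.
  · rw [← holonomy_eq_of_thinHomotopic F γ.thin_slow]
    exact holonomy_congr F fun t => by simp [LazyPath.ofCurve, LazyPath.slow]
  · exact holonomy_eq_one F (z := γ 0) fun t => by simp [LazyPath.ofCurve]

lemma holonomyFunctor_holonomyConnection [FiniteDimensional ℝ E'] :
    (holonomyConnection F hF).holonomyFunctor = F := by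
  refine CategoryTheory.Functor.ext (fun x => rfl) fun x y f => ?_
  simp only [eqToHom_refl, Category.id_comp, Category.comp_id]
  induction f using Quotient.ind with
  | _ γ => exact (holonomy_eq_transport hF γ).symm

variable (E M E' G) in
/-- Connections on the trivial bundle correspond to smooth functors on the path groupoid. -/
def connectionEquivSmoothFunctor [FiniteDimensional ℝ E'] :
    TrivialBundleConnection 𝓘(ℝ, E) M 𝓘(ℝ, E') G ≃ SmoothFunctor 𝓘(ℝ, E) M 𝓘(ℝ, E') G where
  toFun A := ⟨A.holonomyFunctor, A.isSmoothFunctor_holonomyFunctor⟩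
  invFun F := holonomyConnection F.1 F.2
  left_inv := holonomyConnection_holonomyFunctor
  right_inv F := Subtype.ext (holonomyFunctor_holonomyConnection F.2)

end Correspondence

theorem mainTheorem1
    {E : Type*} [NormedAddCommGroup E] [NormedSpace ℝ E] [FiniteDimensional ℝ E]
    {M : Type*} [TopologicalSpace M] [T2Space M] [ChartedSpace E M] [IsManifold 𝓘(ℝ, E) ∞ M]
    {E' : Type*} [NormedAddCommGroup E'] [NormedSpace ℝ E'] [FiniteDimensional ℝ E']
    {G : Type*} [TopologicalSpace G] [T2Space G] [ChartedSpace E' G] [Group G]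
    [LieGroup 𝓘(ℝ, E') ∞ G] :
    (∀ (A : TrivialBundleConnection 𝓘(ℝ, E) M 𝓘(ℝ, E') G) (x y : M)
        (γ : LazyPath 𝓘(ℝ, E) x y), ∃! g : ℝ → G, IsParallelTransport A γ g) ∧
    ∃ Φ : TrivialBundleConnection 𝓘(ℝ, E) M 𝓘(ℝ, E') G ≃ SmoothFunctor 𝓘(ℝ, E) M 𝓘(ℝ, E') G,
      (∀ (A : TrivialBundleConnection 𝓘(ℝ, E) M 𝓘(ℝ, E') G) (x y : M)
        (γ : LazyPath 𝓘(ℝ, E) x y) (g : ℝ → G),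
        IsParallelTransport A γ g → holonomy (Φ A).1 γ = g 1) ∧
      (∀ (F : SmoothFunctor 𝓘(ℝ, E) M 𝓘(ℝ, E') G) (c : ℝ → M)
        (hc : ContMDiff 𝓘(ℝ, ℝ) 𝓘(ℝ, E) ∞ c),
        MDifferentiableAt 𝓘(ℝ, ℝ) 𝓘(ℝ, E')
          (fun s => holonomy F.1 (LazyPath.ofCurve c hc s)) 0 ∧
        tangentMap 𝓘(ℝ, ℝ) 𝓘(ℝ, E') (fun s => holonomy F.1 (LazyPath.ofCurve c hc s)) ⟨0, (1 : ℝ)⟩ =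
          ⟨1, (Φ.symm F).form (c 0) (mfderiv 𝓘(ℝ, ℝ) 𝓘(ℝ, E) c 0 (1 : ℝ))⟩) := by
  refine ⟨fun A x y γ => ⟨A.transport γ γ.smooth, A.isParallelTransport_transport γ,
    fun g hg => A.eq_transport_of_isParallelTransport hg⟩,
    connectionEquivSmoothFunctor E M E' G, fun A x y γ g hg => ?_, fun F c hc => ?_⟩
  · rw [A.eq_transport_of_isParallelTransport hg]
    rfl
  -- The piece of c with s = 0 is constant, so the holonomy curve passes through 1 there and its
  -- logarithmic derivative is its tangent vector.
  · have h := hasRightLogDerivAt_holonomyForm F.2 hc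
    refine ⟨(hasRightLogDerivAt_iff_tangentMap.1 h).1, h.tangentMap_eq ?_⟩
    exact holonomy_eq_one F.1 (z := c 0) fun t => by simp [LazyPath.ofCurve]

end
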